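/- Let $X$ be the Cantor set (a compact, metrizable, totally disconnected space without isolated points), let $U,V\subseteq X$ be open with $U\neq X$, and let $h:U\to V$ be a homeomorphism. Let $\theta=(\{X_n\}_{n\in\mathbb Z},\{h_n\}_{n\in\mathbb Z})$ be the partial action of $\mathbb Z$ on $X$ generated by $h$, that is, $X_{-n}=\operatorname{dom}(h^n)$ and $h_n=h^n:X_{-n}\to X_n$ for $n\in\mathbb Z$. Let $R$ be the equivalence relation on $\mathbb Z\times X$ given by $$(r,x)\sim(s,y)\iff x\in X_{s-r}\ \text{ and }\ h_{r-s}(x)=y ,$$ regarded as an étale groupoid with the topology inherited from $\mathbb Z\times X\times\mathbb Z\times X$. Let $C_r^*(R)$ be its reduced C*-algebra, i.e. the completion of the convolution *-algebra $C_c(R)$ in the norm $\sup_u\|\lambda_u(f)\|$, where $\lambda_u$ is the left regular representation of $C_c(R)$ on $\ell^2([u])$, $u\in\mathbb Z\times X$. Let $B=(B_t)_{t\in\mathbb Z}$, $B_t=C_0(X_t)\delta_t$, be the Fell bundle of $\theta$, with product $(a\delta_t)(b\delta_s)=\alpha_t(\alpha_{-t}(a)b)\delta_{t+s}$ and involution $(a\delta_t)^*=\alpha_{-t}(\bar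 a)\delta_{-t}$, where $\alpha_t(a)=a\circ h_t^{-1}$ for $a\in C_0(X_{-t})$. Let $k_c(B)$ be the *-algebra of finitely supported functions $k:\mathbb Z\times\mathbb Z\to B$ with $k(r,s)\in B_{r-s}$, with $(k_1*k_2)(r,s)=\sum_t k_1(r,t)k_2(t,s)$, $k^*(r,s)=k(s,r)^*$ and norm $\|k\|=\big(\sum_{r,s}\|k(r,s)\|^2\big)^{1/2}$, and let the envelope C*-algebra $k(B)$ of $\theta$ be the universal (enveloping) C*-algebra of the completion of $k_c(B)$ in this norm. Then $C_r^*(R)$ is an AF-algebra, and the envelope C*-algebra $k(B)$ is an AF-algebra. (A C*-algebra is an AF-algebra if it is the norm closure of the union of an increasing sequence of finite-dimensional *-subalgebras.) -/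

import Mathlib

open Set Filter Topology
open scoped ENNReal ComplexConjugate

noncomputable section

universe u v

set_option linter.unusedSectionVars false

/-! ### Partial actions -/

/-- A (topological) partial action of a group `G`, written additively, on a space `X`: open sets
`X_t = dom t` and homeomorphisms `h_t = hom t : X_{-t} → X_t`. -/
structure PartialAction (G X : Type*) [AddGroup G] [TopologicalSpace X] where
  dom : G → Set X
  hom : G → OpenPartialHomeomorph X X
  source_hom : ∀ t, (hom t).source = dom (-t)
  target_hom : ∀ t, (hom t).target = dom t
  dom_zero : dom 0 = univ
  hom_zero : ∀ x, hom 0 x = x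
  image_hom : ∀ t s, hom t '' (dom (-t) ∩ dom s) = dom t ∩ dom (t + s)
  hom_hom : ∀ t s x, x ∈ dom (-s) ∩ dom (-s + -t) → hom t (hom s x) = hom (t + s) x

/-- The power `h ^ n`, `n : ℕ`, of a partial homeomorphism, on the largest possible domain. -/
def OpenPartialHomeomorph.iterNat {X : Type*} [TopologicalSpace X]
    (h : OpenPartialHomeomorph X X) : ℕ → OpenPartialHomeomorph X X
  | 0 => OpenPartialHomeomorph.refl X
  | n + 1 => (h.iterNat n).trans h

/-- The power `h ^ n`, `n : ℤ`, of a partial homeomorphism: `h ^ (-n)` is the inverse of `h ^ n`. -/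
def OpenPartialHomeomorph.iterInt {X : Type*} [TopologicalSpace X]
    (h : OpenPartialHomeomorph X X) : ℤ → OpenPartialHomeomorph X X
  | Int.ofNat n => h.iterNat n
  | Int.negSucc n => (h.iterNat (n + 1)).symm

namespace PartialAction

section Powers

variable {X : Type*} [TopologicalSpace X] (h : OpenPartialHomeomorph X X)

/-- `y = h ^ n x`, with `x` in the domain of `h ^ n`. -/
def PowRel (n : ℤ) (x y : X) : Prop := x ∈ (h.iterInt n).source ∧ h.iterInt n x = y

theorem iterInt_neg_ofNat (n : ℕ) : h.iterInt (-(n : ℤ)) = (h.iterNat n).symm := by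
  cases n with
  | zero => rfl
  | succ n => rfl

theorem iterInt_neg (n : ℤ) : h.iterInt (-n) = (h.iterInt n).symm := by
  obtain ⟨n, rfl | rfl⟩ := n.eq_nat_or_neg
  · exact iterInt_neg_ofNat h n
  · rw [iterInt_neg_ofNat, neg_neg, OpenPartialHomeomorph.symm_symm]; rfl

theorem powRel_neg (n : ℤ) (x y : X) : PowRel h (-n) x y ↔ PowRel h n y x := by
  unfold PowRel
  rw [iterInt_neg]
  constructor
  · rintro ⟨h1, rfl⟩
    exact ⟨(h.iterInt n).map_target h1, (h.iterInt n).right_inv h1⟩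
  · rintro ⟨h1, rfl⟩
    exact ⟨(h.iterInt n).map_source h1, (h.iterInt n).left_inv h1⟩

theorem powRel_fun {n : ℤ} {x y z : X} (hy : PowRel h n x y) (hz : PowRel h n x z) : y = z :=
  hy.2.symm.trans hz.2

theorem powRel_inj {n : ℤ} {x y z : X} (hy : PowRel h n y x) (hz : PowRel h n z x) : y = z :=
  powRel_fun h ((powRel_neg h n x y).2 hy) ((powRel_neg h n x z).2 hz)

theorem powRel_succ (n : ℕ) (x z : X) :
    PowRel h ((n + 1 : ℕ) : ℤ) x z ↔ ∃ y, PowRel h (n : ℤ) x y ∧ y ∈ h.source ∧ h y = z := by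
  change (x ∈ ((h.iterNat n).trans h).source ∧ ((h.iterNat n).trans h) x = z) ↔
    ∃ y, (x ∈ (h.iterNat n).source ∧ h.iterNat n x = y) ∧ y ∈ h.source ∧ h y = z
  rw [OpenPartialHomeomorph.trans_source]
  constructor
  · rintro ⟨⟨h1, h2⟩, h3⟩
    exact ⟨_, ⟨h1, rfl⟩, h2, h3⟩
  · rintro ⟨y, ⟨h1, rfl⟩, h2, h3⟩
    exact ⟨⟨h1, h2⟩, h3⟩

theorem powRel_zero (x y : X) : PowRel h 0 x y ↔ x = y := by
  change (x ∈ (univ : Set X) ∧ x = y) ↔ x = y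
  simp

theorem powRel_add_nat (m n : ℕ) (x z : X) :
    PowRel h (m + n : ℤ) x z ↔ ∃ y, PowRel h (m : ℤ) x y ∧ PowRel h (n : ℤ) y z := by
  induction n generalizing z with
  | zero => simp [powRel_zero]
  | succ n ih =>
    have e : (m + (n + 1 : ℕ) : ℤ) = ((m + n + 1 : ℕ) : ℤ) := by push_cast; ring
    rw [e, powRel_succ]
    simp only [powRel_succ]
    push_cast
    simp only [ih]
    constructor
    · rintro ⟨y, ⟨w, h1, h2⟩, h3⟩
      exact ⟨w, h1, y, h2, h3⟩
    · rintro ⟨w, h1, y, h2, h3⟩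
      exact ⟨y, ⟨w, h1, h2⟩, h3⟩

theorem powRel_add_aux {m n : ℕ} {x y z : X} (h1 : PowRel h (m : ℤ) x y)
    (h2 : PowRel h (n : ℤ) z y) : PowRel h (m - n : ℤ) x z := by
  rcases le_total n m with hl | hl
  · obtain ⟨k, rfl⟩ := Nat.exists_eq_add_of_le' hl
    have h1' : PowRel h (k + n : ℤ) x y := by exact_mod_cast h1
    obtain ⟨w, h3, h4⟩ := (powRel_add_nat h k n x y).1 h1'
    obtain rfl := powRel_inj h h4 h2
    simpa using h3
  · obtain ⟨k, rfl⟩ := Nat.exists_eq_add_of_le' hl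
    have h2' : PowRel h (k + m : ℤ) z y := by exact_mod_cast h2
    obtain ⟨w, h3, h4⟩ := (powRel_add_nat h k m z y).1 h2'
    obtain rfl := powRel_inj h h4 h1
    rw [← powRel_neg]
    simpa using h3

theorem powRel_add_aux' {m n : ℕ} {x y z : X} (h1 : PowRel h (m : ℤ) y x)
    (h2 : PowRel h (n : ℤ) y z) : PowRel h (n - m : ℤ) x z := by
  rcases le_total n m with hl | hl
  · obtain ⟨k, rfl⟩ := Nat.exists_eq_add_of_le hl
    have h1' : PowRel h (n + k : ℤ) y x := by exact_mod_cast h1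
    obtain ⟨w, h3, h4⟩ := (powRel_add_nat h n k y x).1 h1'
    obtain rfl := powRel_fun h h3 h2
    rw [← powRel_neg]
    simpa using h4
  · obtain ⟨k, rfl⟩ := Nat.exists_eq_add_of_le hl
    have h2' : PowRel h (m + k : ℤ) y z := by exact_mod_cast h2
    obtain ⟨w, h3, h4⟩ := (powRel_add_nat h m k y z).1 h2'
    obtain rfl := powRel_fun h h3 h1
    simpa using h4

theorem powRel_add {m n : ℤ} {x y z : X} (h1 : PowRel h m x y) (h2 : PowRel h n y z) :
    PowRel h (m + n) x z := by
  obtain ⟨m, rfl | rfl⟩ := m.eq_nat_or_neg <;> obtain ⟨n, rfl | rfl⟩ := n.eq_nat_or_neg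
  · exact (powRel_add_nat h m n x z).2 ⟨y, h1, h2⟩
  · rw [powRel_neg] at h2
    exact powRel_add_aux h h1 h2
  · rw [powRel_neg] at h1
    rw [neg_add_eq_sub]
    exact powRel_add_aux' h h1 h2
  · rw [powRel_neg] at h1 h2
    rw [← neg_add_rev, powRel_neg]
    exact (powRel_add_nat h n m z x).2 ⟨y, h2, h1⟩

/-- The partial action of `ℤ` generated by a homeomorphism `h : U → V` between open subsets
`U = h.source`, `V = h.target` of `X`: `X_{-n}` is the domain of `h ^ n`, and `h_n = h ^ n`. -/
def ofHomeo : PartialAction ℤ X where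
  dom n := (h.iterInt (-n)).source
  hom n := h.iterInt n
  source_hom n := by rw [neg_neg]
  target_hom n := by rw [iterInt_neg]; rfl
  dom_zero := rfl
  hom_zero _ := rfl
  image_hom t s := by
    ext y
    constructor
    · rintro ⟨x, ⟨hx1, hx2⟩, rfl⟩
      rw [neg_neg] at hx1
      have h1 : PowRel h t x (h.iterInt t x) := ⟨hx1, rfl⟩
      have h2 : PowRel h (-s) x _ := ⟨hx2, rfl⟩
      have h3 := (powRel_neg h t _ _).2 h1
      refine ⟨h3.1, ?_⟩
      rw [neg_add]
      exact (powRel_add h h3 h2).1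
    · rintro ⟨hy1, hy2⟩
      have h1 : PowRel h (-t) y _ := ⟨hy1, rfl⟩
      have h2 : PowRel h (-(t + s)) y _ := ⟨hy2, rfl⟩
      have h3 := (powRel_neg h t _ _).1 h1
      have h4 := powRel_add h h3 h2
      rw [show t + -(t + s) = -s by ring] at h4
      exact ⟨_, ⟨by rw [neg_neg]; exact h3.1, h4.1⟩, h3.2⟩
  hom_hom t s x hx := by
    obtain ⟨hx1, hx2⟩ := hx
    rw [neg_neg] at hx1
    rw [neg_add_rev, neg_neg, neg_neg] at hx2
    have h1 : PowRel h s x (h.iterInt s x) := ⟨hx1, rfl⟩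
    have h2 : PowRel h (t + s) x _ := ⟨hx2, rfl⟩
    have h3 := powRel_add h ((powRel_neg h s _ _).2 h1) h2
    rw [show -s + (t + s) = t by ring] at h3
    exact h3.2

end Powers

section Basic

variable {G X : Type*} [AddGroup G] [TopologicalSpace X] (θ : PartialAction G X)

theorem isOpen_dom (t : G) : IsOpen (θ.dom t) := θ.target_hom t ▸ (θ.hom t).open_target

theorem mem_dom_zero (x : X) : x ∈ θ.dom 0 := θ.dom_zero ▸ mem_univ x

theorem hom_mem {t : G} {x : X} (hx : x ∈ θ.dom (-t)) : θ.hom t x ∈ θ.dom t :=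
  θ.target_hom t ▸ (θ.hom t).map_source (θ.source_hom t ▸ hx)

theorem hom_neg_hom {t : G} {x : X} (hx : x ∈ θ.dom (-t)) : θ.hom (-t) (θ.hom t x) = x := by
  rw [θ.hom_hom (-t) t x ⟨hx, by simpa using θ.mem_dom_zero x⟩, neg_add_cancel, θ.hom_zero]

theorem hom_hom_neg {t : G} {x : X} (hx : x ∈ θ.dom t) : θ.hom t (θ.hom (-t) x) = x := by
  have := θ.hom_neg_hom (t := -t) (x := x) (by rwa [neg_neg])
  rwa [neg_neg] at this

theorem mem_dom_add {s t : G} {x : X} (hx : x ∈ θ.dom (-t)) (hy : θ.hom t x ∈ θ.dom (-s)) :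
    x ∈ θ.dom (-t + -s) := by
  have : x ∈ θ.hom (-t) '' (θ.dom (- -t) ∩ θ.dom (-s)) :=
    ⟨θ.hom t x, ⟨by rw [neg_neg]; exact θ.hom_mem hx, hy⟩, θ.hom_neg_hom hx⟩
  rw [θ.image_hom] at this
  exact this.2

theorem hom_add {s t : G} {x : X} (hx : x ∈ θ.dom (-t)) (hy : θ.hom t x ∈ θ.dom (-s)) :
    θ.hom s (θ.hom t x) = θ.hom (s + t) x :=
  θ.hom_hom s t x ⟨hx, θ.mem_dom_add hx hy⟩

theorem continuousOn_hom (t : G) : ContinuousOn (θ.hom t) (θ.dom (-t)) :=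
  θ.source_hom t ▸ (θ.hom t).continuousOn

/-- The equivalence relation `R` on `G × X`: `(r, x) ∼ (s, y)` iff `x ∈ X_{-r+s}` and
`h_{-s+r} x = y`, as a subset of `(G × X) × (G × X)`. It carries the subspace topology. -/
def rel : Set ((G × X) × (G × X)) :=
  {p | p.1.2 ∈ θ.dom (-p.1.1 + p.2.1) ∧ θ.hom (-p.2.1 + p.1.1) p.1.2 = p.2.2}

theorem rel_refl (u : G × X) : (u, u) ∈ θ.rel := by
  refine ⟨?_, ?_⟩
  · simpa using θ.mem_dom_zero u.2
  · simp [θ.hom_zero]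

theorem rel_symm {u v : G × X} (h : (u, v) ∈ θ.rel) : (v, u) ∈ θ.rel := by
  obtain ⟨r, x⟩ := u
  obtain ⟨s, y⟩ := v
  obtain ⟨h1, h2⟩ := h
  simp only at h1 h2
  have h1' : x ∈ θ.dom (-(-s + r)) := by simpa using h1
  refine ⟨?_, ?_⟩
  · rw [← h2]; exact θ.hom_mem h1'
  · have := θ.hom_neg_hom h1'
    rw [h2] at this
    simpa using this

theorem rel_trans {u v w : G × X} (h : (u, v) ∈ θ.rel) (h' : (v, w) ∈ θ.rel) :
    (u, w) ∈ θ.rel := by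
  obtain ⟨r, x⟩ := u
  obtain ⟨s, y⟩ := v
  obtain ⟨t, z⟩ := w
  obtain ⟨h1, h2⟩ := h
  obtain ⟨h3, h4⟩ := h'
  simp only at h1 h2 h3 h4
  subst h2
  have h1' : x ∈ θ.dom (-(-s + r)) := by simpa using h1
  have h3' : θ.hom (-s + r) x ∈ θ.dom (-(-t + s)) := by simpa using h3
  have h5 := θ.mem_dom_add h1' h3'
  have h6 := θ.hom_add h1' h3'
  have e1 : -(-s + r) + -(-t + s) = -r + t := by simp [add_assoc]
  have e2 : -t + s + (-s + r) = -t + r := by simp [add_assoc]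
  rw [e1] at h5
  rw [e2, h4] at h6
  exact ⟨h5, h6.symm⟩

/-- The only point in level `t` that can be equivalent to `u`. -/
def move (u : G × X) (t : G) : G × X := (t, θ.hom (-t + u.1) u.2)

theorem eq_move {u v : G × X} (h : (u, v) ∈ θ.rel) : v = θ.move u v.1 :=
  Prod.ext rfl h.2.symm

theorem finsum_eq_sum_move {M : Type*} [AddCommMonoid M] (u : G × X) (S : Finset G)
    (F : G × X → M) (hF : ∀ v, F v ≠ 0 → (u, v) ∈ θ.rel ∧ v.1 ∈ S) :
    ∑ᶠ v, F v = ∑ t ∈ S, F (θ.move u t) := by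
  classical
  rw [finsum_eq_sum_of_support_subset (s := S.image (θ.move u)) F, Finset.sum_image]
  · intro a _ b _ hab
    exact congrArg Prod.fst hab
  · intro v hv
    obtain ⟨h1, h2⟩ := hF v hv
    rw [Finset.coe_image]
    exact ⟨v.1, h2, (θ.eq_move h1).symm⟩

end Basic

/-! ### The convolution algebra of `R` and the reduced C*-algebra -/

section Reduced

variable {G X : Type*} [AddGroup G] [TopologicalSpace G] [DiscreteTopology G]
  [TopologicalSpace X] (θ : PartialAction G X)

/-- `C_c(R)`: continuous, compactly supported functions on `R`, extended by zero to
`(G × X) × (G × X)`. -/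
def Cc : Submodule ℂ ((G × X) × (G × X) → ℂ) where
  carrier := {f | ContinuousOn f θ.rel ∧ ∃ K ⊆ θ.rel, IsCompact K ∧ ∀ p ∉ K, f p = 0}
  add_mem' := by
    rintro f g ⟨hf, K, hK, hKc, hK0⟩ ⟨hg, L, hL, hLc, hL0⟩
    refine ⟨hf.add hg, K ∪ L, union_subset hK hL, hKc.union hLc, fun p hp => ?_⟩
    rw [mem_union, not_or] at hp
    simp [hK0 p hp.1, hL0 p hp.2]
  zero_mem' := ⟨continuousOn_const, ∅, empty_subset _, isCompact_empty, fun _ _ => rfl⟩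
  smul_mem' := by
    rintro c f ⟨hf, K, hK, hKc, hK0⟩
    exact ⟨hf.const_smul c, K, hK, hKc, fun p hp => by simp [hK0 p hp]⟩

variable {θ}

theorem Cc.mem_rel (f : θ.Cc) {p : (G × X) × (G × X)} (hp : f.1 p ≠ 0) : p ∈ θ.rel := by
  obtain ⟨_, K, hK, _, hK0⟩ := f.2
  by_contra h
  exact hp (hK0 p fun h' => h (hK h'))

theorem Cc.exists_levels (f : θ.Cc) :
    ∃ S : Finset G, ∀ p, f.1 p ≠ 0 → p.1.1 ∈ S ∧ p.2.1 ∈ S := by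
  classical
  obtain ⟨_, K, hK, hKc, hK0⟩ := f.2
  have h1 : ((fun p : (G × X) × (G × X) => p.1.1) '' K).Finite :=
    isCompact_iff_finite.1 (hKc.image (by fun_prop))
  have h2 : ((fun p : (G × X) × (G × X) => p.2.1) '' K).Finite :=
    isCompact_iff_finite.1 (hKc.image (by fun_prop))
  refine ⟨h1.toFinset ∪ h2.toFinset, fun p hp => ?_⟩
  have hpK : p ∈ K := by
    by_contra h
    exact hp (hK0 p h)
  simp only [Finset.mem_union, Set.Finite.mem_toFinset]
  exact ⟨Or.inl ⟨p, hpK, rfl⟩, Or.inr ⟨p, hpK, rfl⟩⟩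

theorem Cc.exists_bound (f : θ.Cc) : ∃ C : ℝ, 0 ≤ C ∧ ∀ p, ‖f.1 p‖ ≤ C := by
  obtain ⟨hf, K, hK, hKc, hK0⟩ := f.2
  obtain ⟨C, hC⟩ := hKc.exists_bound_of_continuousOn (hf.mono hK)
  refine ⟨max C 0, le_max_right _ _, fun p => ?_⟩
  by_cases hp : p ∈ K
  · exact (hC p hp).trans (le_max_left _ _)
  · rw [hK0 p hp, norm_zero]; exact le_max_right _ _

theorem Cc.finsum_eq (f : θ.Cc) {S : Finset G}
    (hS : ∀ p, f.1 p ≠ 0 → p.1.1 ∈ S ∧ p.2.1 ∈ S) (φ : G × X → ℂ) (u : G × X) :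
    ∑ᶠ v, f.1 (u, v) * φ v = ∑ t ∈ S, f.1 (u, θ.move u t) * φ (θ.move u t) := by
  refine θ.finsum_eq_sum_move u S (fun v => f.1 (u, v) * φ v) fun v hv => ?_
  have : f.1 (u, v) ≠ 0 := left_ne_zero_of_mul hv
  exact ⟨Cc.mem_rel f this, (hS _ this).2⟩

theorem conv_mem [T2Space X] (f g : θ.Cc) :
    (fun p : (G × X) × (G × X) => ∑ᶠ v, f.1 (p.1, v) * g.1 (v, p.2)) ∈ θ.Cc := by
  obtain ⟨S, hS⟩ := Cc.exists_levels f
  obtain ⟨hf, K, hK, hKc, hK0⟩ := f.2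
  obtain ⟨hg, L, hL, hLc, hL0⟩ := g.2
  refine ⟨?_, ?_⟩
  · have key : (fun p : (G × X) × (G × X) => ∑ᶠ v, f.1 (p.1, v) * g.1 (v, p.2)) =
        fun p => ∑ t ∈ S, f.1 (p.1, θ.move p.1 t) * g.1 (θ.move p.1 t, p.2) :=
      funext fun p => Cc.finsum_eq f hS (fun v => g.1 (v, p.2)) p.1
    rw [key]
    refine continuousOn_finsetSum S fun t _ => ?_
    intro p hp
    -- the first coordinates of the part of the support of `f` that ends in level `t`
    let P : Set (G × X) := Prod.fst '' (K ∩ {q | q.2.1 = t})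
    have hclosed : IsClosed {q : (G × X) × (G × X) | q.2.1 = t} :=
      isClosed_eq (by fun_prop) continuous_const
    have hPc : IsCompact P := (hKc.inter_right hclosed).image continuous_fst
    by_cases hpP : p.1 ∈ P
    · obtain ⟨q, ⟨hqK, hqt⟩, hq⟩ := hpP
      have hq' : q = (p.1, θ.move p.1 t) := by
        have hqr := hK hqK
        have e : q.2 = θ.move q.1 q.2.1 := θ.eq_move (u := q.1) (v := q.2) hqr
        have hqt' : q.2.1 = t := hqt
        rw [hqt', hq] at e
        exact Prod.ext hq e
      have hmr : (p.1, θ.move p.1 t) ∈ θ.rel := hq' ▸ hK hqK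
      have hdom : p.1.2 ∈ θ.dom (-p.1.1 + t) := hmr.1
      -- a neighbourhood of `p` on which the level of `p.1` is constant and `move` is defined
      let N : Set ((G × X) × (G × X)) := {q | q.1.1 = p.1.1 ∧ q.1.2 ∈ θ.dom (-p.1.1 + t)}
      have hN : N ∈ 𝓝 p := by
        have o1 : IsOpen {q : (G × X) × (G × X) | q.1.1 = p.1.1} :=
          (isOpen_discrete {p.1.1}).preimage
            (f := fun q : (G × X) × (G × X) => q.1.1) (by fun_prop)
        have o2 : IsOpen {q : (G × X) × (G × X) | q.1.2 ∈ θ.dom (-p.1.1 + t)} :=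
          (θ.isOpen_dom _).preimage (f := fun q : (G × X) × (G × X) => q.1.2) (by fun_prop)
        exact (o1.inter o2).mem_nhds ⟨rfl, hdom⟩
      have hNrel : ∀ q ∈ N, (q.1, θ.move q.1 t) ∈ θ.rel := by
        rintro q ⟨h1, h2⟩
        refine ⟨?_, rfl⟩
        change q.1.2 ∈ θ.dom (-q.1.1 + t)
        rw [h1]; exact h2
      have hmove : ContinuousOn (fun q : (G × X) × (G × X) => θ.move q.1 t) N := by
        have c1 : ContinuousOn
            (fun q : (G × X) × (G × X) => ((t, θ.hom (-t + p.1.1) q.1.2) : G × X)) N := by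
          refine continuousOn_const.prodMk ?_
          refine (θ.continuousOn_hom (-t + p.1.1)).comp (by fun_prop) ?_
          rintro q ⟨_, h2⟩
          simpa using h2
        refine c1.congr ?_
        rintro q ⟨h1, _⟩
        simp [move, h1]
      have hc : ContinuousOn
          (fun q : (G × X) × (G × X) => f.1 (q.1, θ.move q.1 t) * g.1 (θ.move q.1 t, q.2))
          (θ.rel ∩ N) := by
        refine ContinuousOn.mul ?_ ?_
        · refine hf.comp (continuous_fst.continuousOn.prodMk (hmove.mono inter_subset_right)) ?_
          exact fun q hq => hNrel q hq.2
        · refine hg.comp ((hmove.mono inter_subset_right).prodMk continuous_snd.continuousOn) ?_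
          exact fun q hq => θ.rel_trans (θ.rel_symm (hNrel q hq.2)) hq.1
      exact (continuousWithinAt_inter hN).1 (hc p ⟨hp, mem_of_mem_nhds hN⟩)
    · have hopen : IsOpen {q : (G × X) × (G × X) | q.1 ∉ P} :=
        hPc.isClosed.isOpen_compl.preimage continuous_fst
      have hz : ∀ q : (G × X) × (G × X), q.1 ∉ P →
          f.1 (q.1, θ.move q.1 t) * g.1 (θ.move q.1 t, q.2) = 0 := by
        intro q hq
        have h0 : f.1 (q.1, θ.move q.1 t) = 0 :=
          hK0 _ fun hmem => hq ⟨(q.1, θ.move q.1 t), ⟨hmem, rfl⟩, rfl⟩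
        rw [h0, zero_mul]
      refine ContinuousAt.continuousWithinAt ?_
      refine (continuousAt_const (y := (0 : ℂ))).congr ?_
      filter_upwards [hopen.mem_nhds hpP] with q hq
      exact (hz q hq).symm
  · refine ⟨(fun q : ((G × X) × (G × X)) × ((G × X) × (G × X)) => (q.1.1, q.2.2)) ''
      ((K ×ˢ L) ∩ {q | q.1.2 = q.2.1}), ?_, ?_, ?_⟩
    · rintro _ ⟨⟨⟨u, v⟩, ⟨v', w⟩⟩, ⟨⟨h1, h2⟩, h3⟩, rfl⟩
      have h3' : v = v' := h3
      subst h3'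
      exact θ.rel_trans (hK h1) (hL h2)
    · refine ((hKc.prod hLc).inter_right ?_).image (by fun_prop)
      exact isClosed_eq (by fun_prop) (by fun_prop)
    · intro p hp
      refine finsum_eq_zero_of_forall_eq_zero fun v => ?_
      by_contra hne
      have h1 : (p.1, v) ∈ K := by
        by_contra h
        exact left_ne_zero_of_mul hne (hK0 _ h)
      have h2 : (v, p.2) ∈ L := by
        by_contra h
        exact right_ne_zero_of_mul hne (hL0 _ h)
      exact hp ⟨((p.1, v), (v, p.2)), ⟨⟨h1, h2⟩, rfl⟩, rfl⟩

theorem adj_mem (f : θ.Cc) :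
    (fun p : (G × X) × (G × X) => conj (f.1 (p.2, p.1))) ∈ θ.Cc := by
  obtain ⟨hf, K, hK, hKc, hK0⟩ := f.2
  refine ⟨?_, Prod.swap '' K, ?_, hKc.image continuous_swap, ?_⟩
  · refine Complex.continuous_conj.comp_continuousOn (hf.comp continuous_swap.continuousOn ?_)
    exact fun p hp => θ.rel_symm hp
  · rintro _ ⟨p, hp, rfl⟩
    exact θ.rel_symm (hK hp)
  · intro p hp
    have : (p.2, p.1) ∉ K := fun h => hp ⟨_, h, rfl⟩
    simp [hK0 _ this]

/-- The convolution product `(f * g)(u, w) = ∑_{v ∼ u} f(u, v) g(v, w)` on `C_c(R)`. -/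
instance Cc.instMul [T2Space X] : Mul θ.Cc := ⟨fun f g => ⟨_, conv_mem f g⟩⟩

/-- The involution `f*(u, v) = conj (f (v, u))` on `C_c(R)`. -/
instance Cc.instStar : Star θ.Cc := ⟨fun f => ⟨_, adj_mem f⟩⟩

theorem Cc.mul_apply [T2Space X] (f g : θ.Cc) (u w : G × X) :
    (f * g).1 (u, w) = ∑ᶠ v, f.1 (u, v) * g.1 (v, w) := rfl

theorem Cc.star_apply (f : θ.Cc) (u v : G × X) : (star f).1 (u, v) = conj (f.1 (v, u)) := rfl

/-- The Hilbert space `ℓ²(Y)`. -/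
abbrev Ell2 (Y : Type*) : Type _ := lp (fun _ : Y => ℂ) 2

theorem exists_weighted_comp {Y : Type*} (c : Y → ℂ) (σ : Y → Y) (C : ℝ) (hC0 : 0 ≤ C)
    (hC : ∀ v, ‖c v‖ ≤ C) (hσ : InjOn σ {v | c v ≠ 0}) :
    ∃ T : Ell2 Y →L[ℂ] Ell2 Y, ∀ ξ v, T ξ v = c v * ξ (σ v) := by
  classical
  have two : (0 : ℝ) < (2 : ℝ≥0∞).toReal := by norm_num
  have bound : ∀ (ξ : Ell2 Y) (s : Finset Y),
      ∑ v ∈ s, ‖c v * ξ (σ v)‖ ^ (2 : ℝ≥0∞).toReal ≤ (C * ‖ξ‖) ^ (2 : ℝ≥0∞).toReal := by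
    intro ξ s
    have h1 : ∑ v ∈ s, ‖c v * ξ (σ v)‖ ^ (2 : ℝ≥0∞).toReal
        = ∑ v ∈ s.filter (fun v => c v ≠ 0), ‖c v * ξ (σ v)‖ ^ (2 : ℝ≥0∞).toReal := by
      rw [Finset.sum_filter_of_ne]
      intro v _ hv hcv
      simp [hcv] at hv
    rw [h1]
    calc ∑ v ∈ s.filter (fun v => c v ≠ 0), ‖c v * ξ (σ v)‖ ^ (2 : ℝ≥0∞).toReal
        ≤ ∑ v ∈ s.filter (fun v => c v ≠ 0),
            C ^ (2 : ℝ≥0∞).toReal * ‖ξ (σ v)‖ ^ (2 : ℝ≥0∞).toReal := by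
          refine Finset.sum_le_sum fun v _ => ?_
          rw [← Real.mul_rpow hC0 (norm_nonneg _), norm_mul]
          gcongr
          exact hC v
      _ = C ^ (2 : ℝ≥0∞).toReal *
            ∑ w ∈ (s.filter (fun v => c v ≠ 0)).image σ, ‖ξ w‖ ^ (2 : ℝ≥0∞).toReal := by
          rw [← Finset.mul_sum, Finset.sum_image]
          intro a ha b hb hab
          refine hσ ?_ ?_ hab
          · exact (Finset.mem_filter.1 ha).2
          · exact (Finset.mem_filter.1 hb).2
      _ ≤ C ^ (2 : ℝ≥0∞).toReal * ‖ξ‖ ^ (2 : ℝ≥0∞).toReal := by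
          gcongr
          exact lp.sum_rpow_le_norm_rpow two ξ _
      _ = _ := (Real.mul_rpow hC0 (norm_nonneg _)).symm
  let L : Ell2 Y →ₗ[ℂ] Ell2 Y :=
    { toFun := fun ξ => ⟨fun v => c v * ξ (σ v), memℓp_gen' (bound ξ)⟩
      map_add' := fun ξ η => by
        ext v
        change c v * (ξ (σ v) + η (σ v)) = c v * ξ (σ v) + c v * η (σ v)
        ring
      map_smul' := fun a ξ => by
        ext v
        change c v * (a * ξ (σ v)) = a * (c v * ξ (σ v))
        ring }
  refine ⟨L.mkContinuous C fun ξ => ?_, fun ξ v => rfl⟩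
  exact lp.norm_le_of_forall_sum_le two (by positivity) (bound ξ)

theorem exists_regular (f : θ.Cc) :
    ∃ T : Ell2 (G × X) →L[ℂ] Ell2 (G × X), ∀ ξ u, T ξ u = ∑ᶠ v, f.1 (u, v) * ξ v := by
  classical
  obtain ⟨S, hS⟩ := Cc.exists_levels f
  obtain ⟨C, hC0, hC⟩ := Cc.exists_bound f
  have H : ∀ r t : G, ∃ T : Ell2 (G × X) →L[ℂ] Ell2 (G × X), ∀ ξ u,
      T ξ u = (if u.1 = r then f.1 (u, θ.move u t) else 0) * ξ (θ.move u t) := by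
    intro r t
    refine exists_weighted_comp _ (fun u => θ.move u t) C hC0 ?_ ?_
    · intro u
      split_ifs
      · exact hC _
      · simpa using hC0
    · rintro ⟨a, x⟩ hu ⟨b, y⟩ hv huv
      simp only [ne_eq, mem_ofPred_eq, ite_eq_right_iff, Classical.not_imp] at hu hv
      obtain ⟨rfl, hu⟩ := hu
      obtain ⟨rfl, hv⟩ := hv
      have h1 := θ.rel_symm (Cc.mem_rel f hu)
      have h2 := θ.rel_symm (Cc.mem_rel f hv)
      simp only at huv
      rw [← huv] at h2
      rw [θ.eq_move h1, θ.eq_move h2]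
  choose T hT using H
  refine ⟨∑ r ∈ S, ∑ t ∈ S, T r t, fun ξ u => ?_⟩
  rw [Cc.finsum_eq f hS (fun v => ξ v) u]
  simp only [sum_apply, lp.coeFn_sum, Finset.sum_apply, hT, ite_mul, zero_mul]
  rw [Finset.sum_comm]
  refine Finset.sum_congr rfl fun t _ => ?_
  rw [Finset.sum_ite_eq]
  split_ifs with h
  · rfl
  · have : f.1 (u, θ.move u t) = 0 := by
      by_contra h0
      exact h (hS _ h0).1
    rw [this, zero_mul]

/-- The operator `λ(f)` on `ℓ²(G × X)`: `(λ(f) ξ)(u) = ∑_{v ∼ u} f(u, v) ξ(v)`. -/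
def regularOp (f : θ.Cc) : Ell2 (G × X) →L[ℂ] Ell2 (G × X) where
  toFun ξ := ⟨fun u => ∑ᶠ v, f.1 (u, v) * ξ v, by
    obtain ⟨T, hT⟩ := exists_regular f
    have : (fun u => ∑ᶠ v, f.1 (u, v) * ξ v) = T ξ := funext fun u => (hT ξ u).symm
    rw [this]
    exact lp.memℓp (T ξ)⟩
  map_add' ξ η := by
    obtain ⟨T, hT⟩ := exists_regular f
    ext u
    change ∑ᶠ v, f.1 (u, v) * (ξ + η) v = ∑ᶠ v, f.1 (u, v) * ξ v + ∑ᶠ v, f.1 (u, v) * η v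
    rw [← hT, ← hT, ← hT, map_add]; rfl
  map_smul' a ξ := by
    obtain ⟨T, hT⟩ := exists_regular f
    ext u
    change ∑ᶠ v, f.1 (u, v) * (a • ξ) v = a • ∑ᶠ v, f.1 (u, v) * ξ v
    rw [← hT, ← hT, map_smul]; rfl
  cont := by
    obtain ⟨T, hT⟩ := exists_regular f
    refine T.continuous.congr fun ξ => ?_
    ext u
    exact hT ξ u

theorem regularOp_apply (f : θ.Cc) (ξ : Ell2 (G × X)) (u : G × X) :
    regularOp f ξ u = ∑ᶠ v, f.1 (u, v) * ξ v := rfl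

theorem regularOp_single (f : θ.Cc) [DecidableEq (G × X)] (u v : G × X) :
    regularOp f (lp.single 2 v (1 : ℂ)) u = f.1 (u, v) := by
  rw [regularOp_apply, finsum_eq_single _ v]
  · simp
  · intro w hw
    simp [hw]

theorem regularOp_injective : Function.Injective (regularOp (θ := θ)) := by
  classical
  intro f g hfg
  apply Subtype.ext
  funext p
  rw [← regularOp_single f p.1 p.2, ← regularOp_single g p.1 p.2, hfg]

theorem regularOp_zero : regularOp (0 : θ.Cc) = 0 := by
  ext ξ u
  rw [regularOp_apply]
  change ∑ᶠ v, (0 : ℂ) * ξ v = 0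
  simp

theorem Cc.finite_support (f : θ.Cc) (φ : G × X → ℂ) (u : G × X) :
    (Function.support fun v => f.1 (u, v) * φ v).Finite := by
  classical
  obtain ⟨S, hS⟩ := Cc.exists_levels f
  refine (S.image (θ.move u)).finite_toSet.subset fun v hv => ?_
  have : f.1 (u, v) ≠ 0 := left_ne_zero_of_mul hv
  rw [Finset.coe_image]
  exact ⟨v.1, (hS _ this).2, (θ.eq_move (Cc.mem_rel f this)).symm⟩

theorem regularOp_add (f g : θ.Cc) : regularOp (f + g) = regularOp f + regularOp g := by
  ext ξ u
  change ∑ᶠ v, (f.1 (u, v) + g.1 (u, v)) * ξ v = ∑ᶠ v, f.1 (u, v) * ξ v + ∑ᶠ v, g.1 (u, v) * ξ v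
  rw [← finsum_add_distrib (Cc.finite_support f _ u) (Cc.finite_support g _ u)]
  simp only [add_mul]

theorem regularOp_smul (a : ℂ) (f : θ.Cc) : regularOp (a • f) = a • regularOp f := by
  ext ξ u
  change ∑ᶠ v, (a * f.1 (u, v)) * ξ v = a * ∑ᶠ v, f.1 (u, v) * ξ v
  rw [mul_finsum]
  simp only [mul_assoc]

theorem regularOp_mul [T2Space X] (f g : θ.Cc) :
    regularOp (f * g) = regularOp f * regularOp g := by
  obtain ⟨S, hS⟩ := Cc.exists_levels f
  ext ξ u
  rw [mul_apply_eq_comp, regularOp_apply, regularOp_apply]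
  rw [Cc.finsum_eq f hS (fun v => regularOp g ξ v) u]
  simp only [Cc.mul_apply, regularOp_apply]
  have : ∀ w, (∑ᶠ v, f.1 (u, v) * g.1 (v, w)) * ξ w
      = ∑ t ∈ S, f.1 (u, θ.move u t) * (g.1 (θ.move u t, w) * ξ w) := by
    intro w
    rw [Cc.finsum_eq f hS (fun v => g.1 (v, w)) u, Finset.sum_mul]
    simp only [mul_assoc]
  simp only [this]
  rw [finsum_sum_comm]
  · refine Finset.sum_congr rfl fun t _ => ?_
    rw [mul_finsum]
  · intro t _
    refine (Cc.finite_support g (fun w => ξ w) (θ.move u t)).subset fun w hw => ?_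
    exact right_ne_zero_of_mul hw

theorem regularOp_star (f : θ.Cc) : regularOp (star f) = star (regularOp f) := by
  classical
  ext ξ u
  have h1 : star (regularOp f) ξ u = inner ℂ (lp.single 2 u (1 : ℂ)) (star (regularOp f) ξ) := by
    rw [lp.inner_single_left]; simp
  rw [h1, ContinuousLinearMap.star_eq_adjoint, ContinuousLinearMap.adjoint_inner_right,
    lp.inner_eq_tsum, regularOp_apply]
  rw [← tsum_eq_finsum (L := SummationFilter.unconditional _)
    (Cc.finite_support (star f) (fun v => ξ v) u)]
  refine tsum_congr fun v => ?_
  rw [regularOp_single, Cc.star_apply]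
  simp [mul_comm]

instance Cc.instNonUnitalRing [T2Space X] : NonUnitalRing θ.Cc :=
  { (inferInstance : AddCommGroup θ.Cc), Cc.instMul with
    left_distrib := fun a b c => regularOp_injective <| by
      simp only [regularOp_mul, regularOp_add, mul_add]
    right_distrib := fun a b c => regularOp_injective <| by
      simp only [regularOp_mul, regularOp_add, add_mul]
    zero_mul := fun a => regularOp_injective <| by
      simp only [regularOp_mul, regularOp_zero, zero_mul]
    mul_zero := fun a => regularOp_injective <| by
      simp only [regularOp_mul, regularOp_zero, mul_zero]
    mul_assoc := fun a b c => regularOp_injective <| by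
      simp only [regularOp_mul, mul_assoc] }

instance Cc.instStarRing [T2Space X] : StarRing θ.Cc :=
  { Cc.instStar with
    star_involutive := fun a => regularOp_injective <| by
      simp only [regularOp_star, star_star]
    star_mul := fun a b => regularOp_injective <| by
      simp only [regularOp_star, regularOp_mul, star_mul]
    star_add := fun a b => regularOp_injective <| by
      simp only [regularOp_star, regularOp_add, star_add] }

variable (θ)

/-- The regular representation of the *-algebra `C_c(R)` on
`ℓ²(G × X) = ⨁ ℓ²(C)`, the sum over all `R`-equivalence classes `C`; its summands are the
left regular representations `λ_u : C_c(R) → B(ℓ²[u])`, one for each class `[u]`. -/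
def regularRep [T2Space X] : θ.Cc →⋆ₙₐ[ℂ] (Ell2 (G × X) →L[ℂ] Ell2 (G × X)) where
  toFun := regularOp
  map_smul' := regularOp_smul
  map_zero' := regularOp_zero
  map_add' := regularOp_add
  map_mul' := regularOp_mul
  map_star' := regularOp_star

/-- The reduced C*-algebra `C_r*(R)`: the completion of `C_c(R)` in the reduced norm
`‖f‖ = sup_u ‖λ_u(f)‖`, that is, the norm closure of the image of `C_c(R)` under the regular
representation. -/
def reducedSubalgebra [T2Space X] :
    NonUnitalStarSubalgebra ℂ (Ell2 (G × X) →L[ℂ] Ell2 (G × X)) :=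
  (NonUnitalStarAlgHom.range (regularRep θ)).topologicalClosure

instance isClosed_reducedSubalgebra [T2Space X] :
    IsClosed (θ.reducedSubalgebra : Set (Ell2 (G × X) →L[ℂ] Ell2 (G × X))) :=
  NonUnitalStarSubalgebra.isClosed_topologicalClosure _

/-- `C_r*(R)` as a C*-algebra. -/
abbrev ReducedCStarAlgebra [T2Space X] : Type _ := θ.reducedSubalgebra

end Reduced

/-! ### The Fell bundle, `k_c(B)` and the envelope C*-algebra -/

section Envelope

variable {G : Type v} {X : Type u} [AddGroup G] [TopologicalSpace X] (θ : PartialAction G X)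

/-- The fibre `B_t = C_0(X_t) δ_t` over `t` of the Fell bundle of the partial action, for compact
`X`: continuous functions on `X` vanishing off `X_t`. -/
def fiber (t : G) : Submodule ℂ C(X, ℂ) where
  carrier := {a | ∀ x ∉ θ.dom t, a x = 0}
  add_mem' ha hb x hx := by simp [ha x hx, hb x hx]
  zero_mem' _ _ := rfl
  smul_mem' c a ha x hx := by simp [ha x hx]

/-- `k_c(B)`: finitely supported `k : G × G → B` with `k(r, s) ∈ B_{r-s}`. -/
def KcB : Submodule ℂ (G → G → C(X, ℂ)) where
  carrier := {k | (∀ r s, k r s ∈ θ.fiber (r - s)) ∧ {p : G × G | k p.1 p.2 ≠ 0}.Finite}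
  add_mem' := by
    rintro k l ⟨hk, hk'⟩ ⟨hl, hl'⟩
    refine ⟨fun r s => (θ.fiber _).add_mem (hk r s) (hl r s), (hk'.union hl').subset ?_⟩
    intro p hp
    by_contra h
    simp only [mem_union, mem_ofPred_eq, not_or, not_not] at h
    exact hp (by simp [h.1, h.2])
  zero_mem' := ⟨fun r s => (θ.fiber _).zero_mem, by simp⟩
  smul_mem' := by
    rintro c k ⟨hk, hk'⟩
    refine ⟨fun r s => (θ.fiber _).smul_mem c (hk r s), hk'.subset ?_⟩
    intro p hp h
    exact hp (by simp [h])

theorem continuous_of_isOpen {U : Set X} (hU : IsOpen U) {φ : X → ℂ} (h1 : ContinuousOn φ U)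
    (h2 : ∀ x ∉ U, ContinuousAt φ x) : Continuous φ := by
  refine continuous_iff_continuousAt.2 fun x => ?_
  by_cases hx : x ∈ U
  · exact h1.continuousAt (hU.mem_nhds hx)
  · exact h2 x hx

variable [CompactSpace X]

variable {θ} in
/-- The product of the Fell bundle: `(a δ_t)(b δ_s) = α_t(α_{-t}(a) b) δ_{t+s}`, where
`α_t(a) = a ∘ h_{-t}` on `X_t`. Its coefficient is the function `x ↦ a(x) b(h_{-t} x)`
on `X_t`, extended by zero. -/
def fiberMul {t : G} (a : θ.fiber t) (b : C(X, ℂ)) : C(X, ℂ) where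
  toFun x := a.1 x * b (θ.hom (-t) x)
  continuous_toFun := by
    have hc : ContinuousOn (θ.hom (-t)) (θ.dom t) := by
      simpa using θ.continuousOn_hom (-t)
    refine continuous_of_isOpen (θ.isOpen_dom t)
      (a.1.continuous.continuousOn.mul (b.continuous.comp_continuousOn hc)) fun x hx => ?_
    have h0 : a.1 x = 0 := a.2 x hx
    rw [ContinuousAt, h0, zero_mul]
    have hlim : Tendsto (fun y => ‖a.1 y‖ * ‖b‖) (𝓝 x) (𝓝 0) := by
      have : Tendsto (fun y => ‖a.1 y‖ * ‖b‖) (𝓝 x) (𝓝 (‖a.1 x‖ * ‖b‖)) :=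
        (a.1.continuous.norm.mul continuous_const).tendsto x
      simpa [h0] using this
    refine squeeze_zero_norm (fun y => ?_) hlim
    rw [norm_mul]
    gcongr
    exact b.norm_coe_le_norm _

open Classical in
variable {θ} in
/-- The involution of the Fell bundle: `(a δ_t)* = α_{-t}(conj a) δ_{-t}`. Its coefficient is
the function `x ↦ conj (a(h_t x))` on `X_{-t}`, extended by zero. -/
def fiberStar [T2Space X] {t : G} (a : θ.fiber t) : C(X, ℂ) where
  toFun x := if x ∈ θ.dom (-t) then conj (a.1 (θ.hom t x)) else 0
  continuous_toFun := by
    refine continuous_of_isOpen (θ.isOpen_dom (-t)) ?_ fun x hx => ?_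
    · refine ContinuousOn.congr (f := fun x => conj (a.1 (θ.hom t x))) ?_ ?_
      · exact Complex.continuous_conj.comp_continuousOn
          (a.1.continuous.comp_continuousOn (θ.continuousOn_hom t))
      · intro x hx
        simp [hx]
    · rw [ContinuousAt, if_neg hx, Metric.tendsto_nhds]
      intro ε hε
      -- the compact set where `‖a‖ ≥ ε`, pulled back by `h_t`
      have hK : IsCompact {y | ε ≤ ‖a.1 y‖} :=
        (isClosed_le continuous_const a.1.continuous.norm).isCompact
      have hKs : {y | ε ≤ ‖a.1 y‖} ⊆ θ.dom t := by
        intro y hy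
        by_contra h
        have h0 : a.1 y = 0 := a.2 y h
        have hy' : ε ≤ ‖a.1 y‖ := hy
        rw [h0, norm_zero] at hy'
        linarith
      have hc : ContinuousOn (θ.hom (-t)) (θ.dom t) := by
        simpa using θ.continuousOn_hom (-t)
      have hcl := (hK.image_of_continuousOn (hc.mono hKs)).isClosed
      have hxn : x ∉ θ.hom (-t) '' {y | ε ≤ ‖a.1 y‖} := by
        rintro ⟨y, hy, rfl⟩
        exact hx (θ.hom_mem (by simpa using hKs hy))
      filter_upwards [hcl.isOpen_compl.mem_nhds hxn] with z hz
      split_ifs with hzd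
      · rw [dist_zero_right, RCLike.norm_conj]
        by_contra hlt
        exact hz ⟨_, not_lt.1 hlt, θ.hom_neg_hom hzd⟩
      · simpa using hε

theorem fiberMul_apply {t : G} (a : θ.fiber t) (b : C(X, ℂ)) (x : X) :
    fiberMul a b x = a.1 x * b (θ.hom (-t) x) := rfl

open Classical in
theorem fiberStar_apply [T2Space X] {t : G} (a : θ.fiber t) (x : X) :
    fiberStar a x = if x ∈ θ.dom (-t) then conj (a.1 (θ.hom t x)) else 0 := rfl

theorem fiberMul_mem {t s : G} (a : θ.fiber t) (b : θ.fiber s) :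
    fiberMul a b.1 ∈ θ.fiber (t + s) := by
  intro x hx
  rw [fiberMul_apply]
  by_cases h1 : x ∈ θ.dom t
  · by_cases h2 : θ.hom (-t) x ∈ θ.dom s
    · refine absurd ?_ hx
      have := θ.mem_dom_add (t := -t) (s := -s) (x := x) (by simpa using h1) (by simpa using h2)
      simpa using this
    · rw [b.2 _ h2, mul_zero]
  · have h0 : a.1 x = 0 := a.2 x h1
    rw [h0, zero_mul]

theorem fiberStar_mem [T2Space X] {t : G} (a : θ.fiber t) : fiberStar a ∈ θ.fiber (-t) :=
  fun _ hx => if_neg hx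

variable {θ}

/-- The coefficient `k(r, s)` as an element of the fibre `B_{r-s}`. -/
def KcB.entry (k : θ.KcB) (r s : G) : θ.fiber (r - s) := ⟨k.1 r s, k.2.1 r s⟩

theorem KcB.eq_zero (k : θ.KcB) {r s : G} {x : X} (hx : x ∉ θ.dom (r - s)) : k.1 r s x = 0 :=
  k.2.1 r s x hx

theorem KcB.exists_levels (k : θ.KcB) : ∃ S : Finset G, ∀ r s, k.1 r s ≠ 0 → r ∈ S ∧ s ∈ S := by
  classical
  refine ⟨k.2.2.toFinset.image Prod.fst ∪ k.2.2.toFinset.image Prod.snd, fun r s h => ?_⟩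
  have hm : (r, s) ∈ k.2.2.toFinset := by simpa using h
  exact ⟨Finset.mem_union_left _ (Finset.mem_image_of_mem Prod.fst hm),
    Finset.mem_union_right _ (Finset.mem_image_of_mem Prod.snd hm)⟩

theorem KcB.fiberMul_ne_zero {k l : θ.KcB} {r t s : G}
    (h : fiberMul (KcB.entry k r t) (l.1 t s) ≠ 0) : k.1 r t ≠ 0 ∧ l.1 t s ≠ 0 := by
  constructor
  · intro h0
    refine h (ContinuousMap.ext fun x => ?_)
    rw [fiberMul_apply]
    change k.1 r t x * _ = 0
    rw [h0]; simp
  · intro h0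
    refine h (ContinuousMap.ext fun x => ?_)
    rw [fiberMul_apply, h0]; simp

theorem KcB.mul_mem (k l : θ.KcB) :
    (fun r s => ∑ᶠ t, fiberMul (KcB.entry k r t) (l.1 t s)) ∈ θ.KcB := by
  refine ⟨fun r s => ?_, ?_⟩
  · refine finsum_induction (· ∈ θ.fiber (r - s)) (Submodule.zero_mem _)
      (fun _ _ => Submodule.add_mem _) fun t => ?_
    have := θ.fiberMul_mem (KcB.entry k r t) (KcB.entry l t s)
    rwa [sub_add_sub_cancel] at this
  · refine ((k.2.2.image Prod.fst).prod (l.2.2.image Prod.snd)).subset ?_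
    rintro ⟨r, s⟩ h
    obtain ⟨t, ht⟩ : ∃ t, fiberMul (KcB.entry k r t) (l.1 t s) ≠ 0 := by
      by_contra! hall
      exact h (finsum_eq_zero_of_forall_eq_zero hall)
    obtain ⟨h1, h2⟩ := KcB.fiberMul_ne_zero ht
    exact ⟨⟨(r, t), h1, rfl⟩, ⟨(t, s), h2, rfl⟩⟩

/-- The product `(k * l)(r, s) = ∑_t k(r, t) l(t, s)` on `k_c(B)`. -/
instance KcB.instMul : Mul θ.KcB := ⟨fun k l => ⟨_, KcB.mul_mem k l⟩⟩

theorem KcB.star_mem [T2Space X] (k : θ.KcB) :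
    (fun r s => fiberStar (KcB.entry k s r)) ∈ θ.KcB := by
  refine ⟨fun r s => ?_, ?_⟩
  · have := θ.fiberStar_mem (KcB.entry k s r)
    rwa [neg_sub] at this
  · refine (k.2.2.image Prod.swap).subset ?_
    rintro ⟨r, s⟩ h
    refine ⟨(s, r), fun h0 => h (ContinuousMap.ext fun x => ?_), rfl⟩
    have h0' : k.1 s r = 0 := h0
    change fiberStar (KcB.entry k s r) x = 0
    rw [fiberStar_apply]
    simp [KcB.entry, h0']

/-- The involution `k*(r, s) = k(s, r)*` on `k_c(B)`. -/
instance KcB.instStar [T2Space X] : Star θ.KcB := ⟨fun k => ⟨_, KcB.star_mem k⟩⟩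

theorem KcB.mul_def (k l : θ.KcB) (r s : G) :
    (k * l).1 r s = ∑ᶠ t, fiberMul (KcB.entry k r t) (l.1 t s) := rfl

theorem KcB.star_def [T2Space X] (k : θ.KcB) (r s : G) :
    (star k).1 r s = fiberStar (KcB.entry k s r) := rfl

open Classical in
theorem KcB.star_apply [T2Space X] (k : θ.KcB) (r s : G) (x : X) :
    (star k).1 r s x =
      if x ∈ θ.dom (r - s) then conj (k.1 s r (θ.hom (s - r) x)) else 0 := by
  rw [KcB.star_def, fiberStar_apply, neg_sub]; rfl

theorem KcB.mul_apply (k l : θ.KcB) {S : Finset G} (hS : ∀ r s, k.1 r s ≠ 0 → r ∈ S ∧ s ∈ S)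
    (r s : G) (x : X) :
    (k * l).1 r s x = ∑ t ∈ S, k.1 r t x * l.1 t s (θ.hom (t - r) x) := by
  rw [KcB.mul_def, finsum_eq_sum_of_support_subset (s := S)]
  · rw [ContinuousMap.sum_apply]
    refine Finset.sum_congr rfl fun t _ => ?_
    rw [fiberMul_apply, neg_sub]; rfl
  · intro t ht
    exact (hS _ _ (KcB.fiberMul_ne_zero ht).1).2

theorem KcB.ext_apply {k l : θ.KcB} (h : ∀ r s x, k.1 r s x = l.1 r s x) : k = l :=
  Subtype.ext <| funext fun r => funext fun s => ContinuousMap.ext fun x => h r s x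

theorem KcB.exists_levels₂ (k l : θ.KcB) : ∃ S : Finset G,
    (∀ r s, k.1 r s ≠ 0 → r ∈ S ∧ s ∈ S) ∧ (∀ r s, l.1 r s ≠ 0 → r ∈ S ∧ s ∈ S) := by
  classical
  obtain ⟨S, hS⟩ := KcB.exists_levels k
  obtain ⟨T, hT⟩ := KcB.exists_levels l
  refine ⟨S ∪ T, fun r s h => ?_, fun r s h => ?_⟩
  · exact ⟨Finset.mem_union_left _ (hS r s h).1, Finset.mem_union_left _ (hS r s h).2⟩
  · exact ⟨Finset.mem_union_right _ (hT r s h).1, Finset.mem_union_right _ (hT r s h).2⟩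

theorem KcB.mul_levels (k l : θ.KcB) {S : Finset G}
    (hk : ∀ r s, k.1 r s ≠ 0 → r ∈ S ∧ s ∈ S) (hl : ∀ r s, l.1 r s ≠ 0 → r ∈ S ∧ s ∈ S) :
    ∀ r s, (k * l).1 r s ≠ 0 → r ∈ S ∧ s ∈ S := by
  intro r s h
  obtain ⟨t, ht⟩ : ∃ t, fiberMul (KcB.entry k r t) (l.1 t s) ≠ 0 := by
    by_contra! hall
    exact h (finsum_eq_zero_of_forall_eq_zero hall)
  obtain ⟨h1, h2⟩ := KcB.fiberMul_ne_zero ht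
  exact ⟨(hk _ _ h1).1, (hl _ _ h2).2⟩

theorem KcB.mul_assoc' (k l m : θ.KcB) : k * l * m = k * (l * m) := by
  obtain ⟨S, hk, hl⟩ := KcB.exists_levels₂ k l
  refine KcB.ext_apply fun r s x => ?_
  rw [KcB.mul_apply _ _ (KcB.mul_levels k l hk hl), KcB.mul_apply _ _ hk]
  simp only [KcB.mul_apply _ _ hk, KcB.mul_apply _ _ hl, Finset.sum_mul, Finset.mul_sum]
  rw [Finset.sum_comm]
  refine Finset.sum_congr rfl fun t _ => Finset.sum_congr rfl fun t' _ => ?_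
  rw [mul_assoc]
  by_cases h1 : x ∈ θ.dom (r - t)
  · by_cases h2 : θ.hom (t - r) x ∈ θ.dom (t - t')
    · rw [θ.hom_add (by rwa [neg_sub]) (by rwa [neg_sub]), sub_add_sub_cancel]
    · rw [KcB.eq_zero l h2]; simp
  · rw [KcB.eq_zero k h1]; simp

theorem KcB.add_levels (k l : θ.KcB) {S : Finset G}
    (hk : ∀ r s, k.1 r s ≠ 0 → r ∈ S ∧ s ∈ S) (hl : ∀ r s, l.1 r s ≠ 0 → r ∈ S ∧ s ∈ S) :
    ∀ r s, (k + l).1 r s ≠ 0 → r ∈ S ∧ s ∈ S := by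
  intro r s h
  by_cases h1 : k.1 r s = 0
  · refine hl r s fun h2 => h ?_
    change k.1 r s + l.1 r s = 0
    rw [h1, h2, add_zero]
  · exact hk r s h1

theorem KcB.add_apply (k l : θ.KcB) (r s : G) (x : X) :
    (k + l).1 r s x = k.1 r s x + l.1 r s x := rfl

instance KcB.instNonUnitalRing : NonUnitalRing θ.KcB :=
  { (inferInstance : AddCommGroup θ.KcB), KcB.instMul with
    left_distrib := fun a b c => by
      obtain ⟨S, hS⟩ := KcB.exists_levels a
      refine KcB.ext_apply fun r s x => ?_
      rw [KcB.add_apply, KcB.mul_apply a b hS, KcB.mul_apply a c hS]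
      refine (KcB.mul_apply a (b + c) hS r s x).trans ?_
      simp only [KcB.add_apply, mul_add, Finset.sum_add_distrib]
    right_distrib := fun a b c => by
      obtain ⟨S, ha, hb⟩ := KcB.exists_levels₂ a b
      refine KcB.ext_apply fun r s x => ?_
      rw [KcB.add_apply, KcB.mul_apply a c ha, KcB.mul_apply b c hb]
      refine (KcB.mul_apply (a + b) c (KcB.add_levels a b ha hb) r s x).trans ?_
      simp only [KcB.add_apply, add_mul, Finset.sum_add_distrib]
    zero_mul := fun a => by
      refine KcB.ext_apply fun r s x => ?_
      refine (KcB.mul_apply 0 a (S := ∅) (fun r s h => (h rfl).elim) r s x).trans ?_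
      simp
    mul_zero := fun a => by
      obtain ⟨S, hS⟩ := KcB.exists_levels a
      refine KcB.ext_apply fun r s x => ?_
      refine (KcB.mul_apply a 0 hS r s x).trans ?_
      simp
    mul_assoc := KcB.mul_assoc' }

theorem KcB.star_levels [T2Space X] (k : θ.KcB) {S : Finset G}
    (hk : ∀ r s, k.1 r s ≠ 0 → r ∈ S ∧ s ∈ S) :
    ∀ r s, (star k).1 r s ≠ 0 → r ∈ S ∧ s ∈ S := by
  intro r s h
  refine (hk s r fun h0 => h (ContinuousMap.ext fun x => ?_)).symm
  rw [KcB.star_apply, h0]; simp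

theorem KcB.star_mul' [T2Space X] (k l : θ.KcB) : star (k * l) = star l * star k := by
  obtain ⟨S, hk, hl⟩ := KcB.exists_levels₂ k l
  refine KcB.ext_apply fun r s x => ?_
  rw [KcB.star_apply, KcB.mul_apply _ _ (KcB.star_levels l hl), KcB.mul_apply _ _ hk]
  simp only [KcB.star_apply]
  split_ifs with hx
  · rw [map_sum]
    refine Finset.sum_congr rfl fun t _ => ?_
    rw [map_mul]
    have hx' : x ∈ θ.dom (-(s - r)) := by rwa [neg_sub]
    by_cases h1 : x ∈ θ.dom (r - t)
    · have h1' : x ∈ θ.dom (-(t - r)) := by rwa [neg_sub]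
      rw [if_pos h1]
      by_cases h2 : θ.hom (t - r) x ∈ θ.dom (t - s)
      · have h2' : θ.hom (t - r) x ∈ θ.dom (-(s - t)) := by rwa [neg_sub]
        rw [if_pos h2]
        have e := θ.hom_add h1' h2'
        rw [sub_add_sub_cancel] at e
        have e' := θ.hom_neg_hom h2'
        rw [neg_sub, e] at e'
        rw [e, e', mul_comm]
      · rw [if_neg h2, mul_zero, KcB.eq_zero k (r := s) (s := t), map_zero, zero_mul]
        intro h3
        apply h2
        have h3' : θ.hom (s - r) x ∈ θ.dom (-(t - s)) := by rwa [neg_sub]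
        have e := θ.hom_add hx' h3'
        rw [sub_add_sub_cancel] at e
        rw [← e]
        exact θ.hom_mem h3'
    · rw [if_neg h1, zero_mul]
      by_cases h3 : θ.hom (s - r) x ∈ θ.dom (s - t)
      · rw [KcB.eq_zero l (r := t) (s := r), map_zero, mul_zero]
        intro h4
        apply h1
        have h3' : θ.hom (s - r) x ∈ θ.dom (-(t - s)) := by rwa [neg_sub]
        have h5 := θ.mem_dom_add hx' h3'
        simpa using h5
      · rw [KcB.eq_zero k h3, map_zero, zero_mul]
  · symm
    refine Finset.sum_eq_zero fun t _ => ?_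
    split_ifs with h1 h2
    · refine absurd ?_ hx
      have := θ.mem_dom_add (t := t - r) (s := s - t) (x := x) (by rwa [neg_sub])
        (by rwa [neg_sub])
      simpa using this
    all_goals simp

instance KcB.instStarRing [T2Space X] : StarRing θ.KcB :=
  { KcB.instStar with
    star_involutive := fun k => by
      refine KcB.ext_apply fun r s x => ?_
      rw [KcB.star_apply]
      split_ifs with hx
      · have hx' : x ∈ θ.dom (-(s - r)) := by rwa [neg_sub]
        rw [KcB.star_apply, if_pos (θ.hom_mem hx')]
        have := θ.hom_neg_hom hx'
        rw [neg_sub] at this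
        rw [this, Complex.conj_conj]
      · exact (KcB.eq_zero k hx).symm
    star_mul := KcB.star_mul'
    star_add := fun k l => by
      refine KcB.ext_apply fun r s x => ?_
      rw [KcB.add_apply, KcB.star_apply, KcB.star_apply, KcB.star_apply, KcB.add_apply]
      split_ifs <;> simp }

/-- The norm `‖k‖ = (∑_{r,s} ‖k(r, s)‖²)^{1/2}` on `k_c(B)`. -/
def KcB.hsNorm (k : θ.KcB) : ℝ := √(∑ᶠ p : G × G, ‖k.1 p.1 p.2‖ ^ 2)

variable (θ)

/-- A representation, on a Hilbert space, of the Banach *-algebra obtained by completing `k_c(B)`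
in the norm `KcB.hsNorm`. It is given by its restriction to `k_c(B)`: *-representations of a
Banach *-algebra with isometric involution are contractive, and conversely contractive
*-representations of `k_c(B)` extend to the completion. -/
structure EnvelopeRep [T2Space X] where
  H : Type (max u v)
  [instNormed : NormedAddCommGroup H]
  [instInner : InnerProductSpace ℂ H]
  [instComplete : CompleteSpace H]
  toHom : θ.KcB →⋆ₙₐ[ℂ] (H →L[ℂ] H)
  norm_le : ∀ k : θ.KcB, ‖toHom k‖ ≤ KcB.hsNorm k

attribute [instance] EnvelopeRep.instNormed EnvelopeRep.instInner EnvelopeRep.instComplete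

/-- The bounded families of operators, one on the space of each representation. -/
abbrev EnvelopeProduct [T2Space X] : Type _ :=
  lp (fun π : θ.EnvelopeRep => π.H →L[ℂ] π.H) ∞

/-- The universal representation `k ↦ (π(k))_π` of `k_c(B)`; its norm is
`‖k‖ = sup_π ‖π(k)‖`. -/
def universalRep [T2Space X] : θ.KcB →⋆ₙₐ[ℂ] θ.EnvelopeProduct where
  toFun k := ⟨fun π => π.toHom k, memℓp_infty ⟨KcB.hsNorm k, by
    rintro _ ⟨π, rfl⟩
    exact π.norm_le k⟩⟩
  map_smul' c k := by ext π : 2; exact map_smul π.toHom c k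
  map_zero' := by ext π : 2; exact map_zero π.toHom
  map_add' k l := by ext π : 2; exact map_add π.toHom k l
  map_mul' k l := by ext π : 2; exact map_mul π.toHom k l
  map_star' k := by ext π : 2; exact map_star π.toHom k

/-- The envelope C*-algebra `k(B)`, the universal C*-algebra of the completion of `k_c(B)`: the
Hausdorff completion of `k_c(B)` in the C*-seminorm `sup_π ‖π(k)‖` over all representations `π`,
realized as the norm closure of the image of `k_c(B)` under the universal representation. -/
def envelopeSubalgebra [T2Space X] : NonUnitalStarSubalgebra ℂ θ.EnvelopeProduct :=
  (NonUnitalStarAlgHom.range (universalRep θ)).topologicalClosure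

instance isClosed_envelopeSubalgebra [T2Space X] :
    IsClosed (θ.envelopeSubalgebra : Set θ.EnvelopeProduct) :=
  NonUnitalStarSubalgebra.isClosed_topologicalClosure _

/-- `k(B)` as a C*-algebra. -/
abbrev EnvelopeCStarAlgebra [T2Space X] : Type _ := θ.envelopeSubalgebra

end Envelope

end PartialAction

/-! ### AF-algebras -/

/-- A C*-algebra (not necessarily unital) is an AF-algebra if it is the closure of the union of an
increasing sequence of finite-dimensional *-subalgebras. -/
def IsAFAlgebra (A : Type*) [NonUnitalCStarAlgebra A] : Prop :=
  ∃ F : ℕ → NonUnitalStarSubalgebra ℂ A,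
    Monotone F ∧ (∀ n, FiniteDimensional ℂ (F n)) ∧ Dense (⋃ n, (F n : Set A))

end

noncomputable section

universe u v

open TopologicalSpace (Clopens)

/-! A class of R meets each level {t} × X in at most one point. An element of C_c(R) or of k_c(B) is
therefore a finite matrix indexed by levels, whose entries are functions on X vanishing off open
domains. Fix a finite set S of levels and a finite family 𝒲 of clopen sets. The signature of a point
records which levels of S its class meets and which members of 𝒲 contain the representative there.
It depends only on the class (`signature_eq_of_rel`) and takes finitely many values.

The functions that live on levels in S, and whose value at (u, v) ∈ R depends only on the two levels
and the signature, form a finite-dimensional *-algebra. Indeed, in (f * g)(u, w) = ∑_t f(u, v_t)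
g(v_t, w) the signature of u decides whether the point v_t of its class in level t exists, and v_t
has the same signature as u. The domains X_t are open but need not be closed, so a set of constant
signature need not be open. This does no harm, because the algebras are cut out inside C_c(R) and
k_c(B), where continuity is already known.

For density, `exists_locallyConstant_approx` approximates every entry uniformly by a locally
constant function that vanishes off the same open set. Such a function is constant on the atoms of a
finite clopen family, so level and signature determine it. With S fixed, uniform approximation of
entries is approximation in norm: `norm_regularOp_le` handles the reduced norm, while
representations defining k(B) are contractive for the Hilbert–Schmidt norm, which `hsNorm_le`
controls. The pairs (S, 𝒲) form a countable directed set, and `isAFAlgebra_of_directed` concludes.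
-/

/-! ### A criterion for AF-algebras -/

/-- The closure of the image of a *-algebra that is approximated by a countable directed family of
finite-dimensional *-subalgebras is an AF-algebra. -/
theorem isAFAlgebra_of_directed {A B ι : Type*} [NonUnitalRing A] [StarRing A] [Module ℂ A]
    [NonUnitalCStarAlgebra B] (φ : A →⋆ₙₐ[ℂ] B) (D : NonUnitalStarSubalgebra ℂ B)
    [IsClosed (D : Set B)] (hD : (D : Set B) = closure (range φ))
    [Preorder ι] [Nonempty ι] [IsDirectedOrder ι] [Countable ι]
    (F : ι → NonUnitalStarSubalgebra ℂ A) (hmono : Monotone F)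
    (hfin : ∀ i, FiniteDimensional ℂ (F i))
    (happ : ∀ a : A, ∀ ε > (0 : ℝ), ∃ i, ∃ b ∈ F i, ‖φ a - φ b‖ ≤ ε) :
    IsAFAlgebra D := by
  -- A countable directed order has a monotone sequence tending to infinity; along it the family
  -- becomes the increasing sequence that `IsAFAlgebra` asks for.
  obtain ⟨i, himono, hi⟩ := exists_seq_monotone_tendsto_atTop_atTop ι
  have hφD : ∀ a, φ a ∈ D := fun a => by
    rw [← SetLike.mem_coe, hD]
    exact subset_closure ⟨a, rfl⟩
  let ψ : A →⋆ₙₐ[ℂ] D := NonUnitalStarAlgHom.codRestrict φ D hφD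
  refine ⟨fun n => (F (i n)).map ψ, fun m n hmn => ?_, fun n => ?_, fun x => ?_⟩
  · exact (NonUnitalStarSubalgebra.gc_map_comap ψ).monotone_l (hmono (himono hmn))
  · have := hfin (i n)
    let L : F (i n) →ₗ[ℂ] (F (i n)).map ψ :=
      { toFun := fun a => ⟨ψ a.1, NonUnitalStarSubalgebra.mem_map.2 ⟨a.1, a.2, rfl⟩⟩
        map_add' := fun a b => Subtype.ext (map_add ψ a.1 b.1)
        map_smul' := fun c a => Subtype.ext (map_smul ψ c a.1) }
    refine Module.Finite.of_surjective L ?_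
    rintro ⟨_, hx⟩
    obtain ⟨a, ha, rfl⟩ := NonUnitalStarSubalgebra.mem_map.1 hx
    exact ⟨⟨a, ha⟩, rfl⟩
  · rw [Metric.mem_closure_iff]
    intro ε hε
    have hx : x.1 ∈ closure (range φ) := hD ▸ x.2
    obtain ⟨_, ⟨a, rfl⟩, ha⟩ := Metric.mem_closure_iff.1 hx (ε / 2) (half_pos hε)
    obtain ⟨j, b, hb, hab⟩ := happ a (ε / 3) (by positivity)
    obtain ⟨n, hn⟩ := (hi.eventually (eventually_ge_atTop j)).exists
    refine ⟨ψ b, mem_iUnion.2 ⟨n, NonUnitalStarSubalgebra.mem_map.2 ⟨b, hmono hn hb, rfl⟩⟩, ?_⟩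
    calc dist x (ψ b) = dist x.1 (φ b) := rfl
      _ ≤ dist x.1 (φ a) + dist (φ a) (φ b) := dist_triangle _ _ _
      _ < ε := by rw [dist_eq_norm (φ a)]; linarith

/-- A space of functions that factor through a map with finite range is finite-dimensional. -/
theorem finiteDimensional_of_factors {W α γ : Type*} [AddCommGroup W] [Module ℂ W]
    (E : W →ₗ[ℂ] (α → ℂ)) (hE : Function.Injective E) (q : α → γ) (hq : (range q).Finite)
    (h : ∀ w a b, q a = q b → E w a = E w b) : FiniteDimensional ℂ W := by
  have := hq.to_subtype
  -- Restriction to one chosen point in each fibre of `q` loses nothing, so `W` embeds in the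
  -- functions on the finite set `range q`.
  choose g hg using fun b : range q => b.2
  refine Module.Finite.of_injective ((LinearMap.funLeft ℂ ℂ g).comp E) fun w w' hw => hE ?_
  funext a
  have h1 := congrFun hw ⟨q a, a, rfl⟩
  have h2 : q (g ⟨q a, a, rfl⟩) = q a := hg _
  rw [h w _ _ h2.symm, h w' _ _ h2.symm]
  exact h1

/-! ### Approximation by locally constant functions -/

/-- The function `g` is constant on the atoms of the family `𝒲` of clopen sets. -/
def ConstantOnAtoms {X : Type*} [TopologicalSpace X] (𝒲 : Finset (Clopens X)) (g : X → ℂ) : Prop :=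
  ∀ x y, (∀ W ∈ 𝒲, x ∈ W ↔ y ∈ W) → g x = g y

theorem ConstantOnAtoms.mono {X : Type*} [TopologicalSpace X] {𝒲 𝒲' : Finset (Clopens X)}
    {g : X → ℂ} (hg : ConstantOnAtoms 𝒲 g) (h : 𝒲 ⊆ 𝒲') : ConstantOnAtoms 𝒲' g :=
  fun x y hxy => hg x y fun W hW => hxy W (h hW)

/-- A continuous map to a finite discrete set, with suitable values attached, is uniformly close to
`a`, and its fibres serve as 𝒲. Rounding small values to 0 makes the approximation vanish exactly
off `U` as well, so that it stays in the same fibre of the bundle. -/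
theorem exists_locallyConstant_approx {X : Type*} [TopologicalSpace X] [CompactSpace X]
    [T2Space X] [TotallyDisconnectedSpace X] (a : C(X, ℂ)) {U : Set X} (ha : ∀ x ∉ U, a x = 0)
    {ε : ℝ} (hε : 0 < ε) :
    ∃ (𝒲 : Finset (Clopens X)) (g : X → ℂ), IsLocallyConstant g ∧ (∀ x ∉ U, g x = 0) ∧
      (∀ x, ‖a x - g x‖ ≤ ε) ∧ ConstantOnAtoms 𝒲 g := by
  classical
  have hS : {p : ℂ × ℂ | dist p.1 p.2 < ε / 2} ∈ nhdsSet (diagonal ℂ) :=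
    (isOpen_lt (by fun_prop) continuous_const).mem_nhdsSet.2 <| by
      rintro ⟨z, w⟩ (rfl : z = w)
      simpa using hε
  obtain ⟨n, g, c, hg, hgc⟩ := a.exists_finite_approximation_of_mem_nhds_diagonal hS
  have hgl : IsLocallyConstant g := (IsLocallyConstant.iff_continuous g).2 hg
  -- Where `a` is 0 the attached value is smaller than ε / 2, hence rounded to 0. Rounding costs a
  -- further ε / 2, which is why the first approximation is made within ε / 2.
  let c' : Fin n → ℂ := fun i => if ‖c i‖ < ε / 2 then 0 else c i
  refine ⟨Finset.univ.image fun i => ⟨g ⁻¹' {i}, hgl.isClopen_fiber i⟩, c' ∘ g, hgl.comp c',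
    fun x hx => ?_, fun x => ?_, fun x y hxy => ?_⟩
  · have h1 : dist (a x) (c (g x)) < ε / 2 := hgc x
    rw [ha x hx, dist_zero_left] at h1
    exact if_pos h1
  · have h1 : dist (a x) (c (g x)) < ε / 2 := hgc x
    rw [dist_eq_norm] at h1
    by_cases h2 : ‖c (g x)‖ < ε / 2
    · have h3 : (c' ∘ g) x = 0 := if_pos h2
      rw [h3, sub_zero]
      have := norm_sub_norm_le (a x) (c (g x))
      linarith
    · have h3 : (c' ∘ g) x = c (g x) := if_neg h2
      rw [h3]
      linarith
  · have h1 := hxy _ (Finset.mem_image_of_mem _ (Finset.mem_univ (g x)))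
    have h2 : g y = g x := h1.1 rfl
    simp [h2]

/-! ### The invariant signature of a point of `G × X` -/

namespace PartialAction

section Signature

variable {G X : Type*} [AddGroup G] [TopologicalSpace X] (θ : PartialAction G X)

theorem move_rel_iff {u : G × X} {t : G} : (u, θ.move u t) ∈ θ.rel ↔ u.2 ∈ θ.dom (-u.1 + t) :=
  ⟨fun h => h.1, fun h => ⟨h, rfl⟩⟩

theorem move_self (u : G × X) : θ.move u u.1 = u := (θ.eq_move (θ.rel_refl u)).symm

open Classical in
/-- The signature of `u`: the levels in `S` that the class of `u` meets, with the sets in `𝒲`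
that contain its point in that level. It depends only on the class of `u`. -/
def signature (S : Finset G) (𝒲 : Finset (Clopens X)) (u : G × X) : Finset (G × Clopens X) :=
  (S ×ˢ insert ⊤ 𝒲).filter fun p => (u, θ.move u p.1) ∈ θ.rel ∧ (θ.move u p.1).2 ∈ p.2

variable {θ}

/-- Equivalent points have the same representative in every level that their class meets. -/
theorem signature_eq_of_rel {u v : G × X} (h : (u, v) ∈ θ.rel) (S : Finset G)
    (𝒲 : Finset (Clopens X)) : θ.signature S 𝒲 u = θ.signature S 𝒲 v := by
  classical
  refine Finset.filter_congr fun p _ => ⟨?_, ?_⟩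
  · rintro ⟨h1, h2⟩
    have h3 := θ.rel_trans (θ.rel_symm h) h1
    have h4 : θ.move u p.1 = θ.move v p.1 := θ.eq_move h3
    exact ⟨h4 ▸ h3, h4 ▸ h2⟩
  · rintro ⟨h1, h2⟩
    have h3 := θ.rel_trans h h1
    have h4 : θ.move v p.1 = θ.move u p.1 := θ.eq_move h3
    exact ⟨h4 ▸ h3, h4 ▸ h2⟩

/-- This is why ⊤ is adjoined to 𝒲: the pair (t, ⊤) records that the class meets level t even if no
member of 𝒲 contains its point there. -/
theorem mem_rel_of_signature_eq {S : Finset G} {𝒲 : Finset (Clopens X)} {u u' : G × X}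
    (h : θ.signature S 𝒲 u = θ.signature S 𝒲 u') {t : G} (ht : t ∈ S)
    (hu : (u, θ.move u t) ∈ θ.rel) : (u', θ.move u' t) ∈ θ.rel := by
  classical
  have h1 : (t, (⊤ : Clopens X)) ∈ θ.signature S 𝒲 u := by
    simp only [signature, Finset.mem_filter, Finset.mem_product, Finset.mem_insert, true_or,
      and_true, ht, hu, true_and]
    trivial
  rw [h] at h1
  exact (Finset.mem_filter.1 h1).2.1

/-- A point represents its own class in its own level, so level and signature together determine the
atom of 𝒲 in which it lies. -/
theorem mem_clopen_of_signature_eq {S : Finset G} {𝒲 : Finset (Clopens X)} {u u' : G × X}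
    (h : θ.signature S 𝒲 u = θ.signature S 𝒲 u') (hl : u.1 = u'.1) (hS : u.1 ∈ S)
    {W : Clopens X} (hW : W ∈ 𝒲) (hu : u.2 ∈ W) : u'.2 ∈ W := by
  classical
  have h1 : (u.1, W) ∈ θ.signature S 𝒲 u := by
    simp only [signature, Finset.mem_filter, Finset.mem_product, Finset.mem_insert, hW, or_true,
      hS, move_self, θ.rel_refl, hu, and_self]
  rw [h] at h1
  have h2 := (Finset.mem_filter.1 h1).2.2
  rw [hl, move_self] at h2
  exact h2

theorem eq_of_constantOnAtoms {S : Finset G} {𝒲 : Finset (Clopens X)} {g : X → ℂ}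
    (hg : ConstantOnAtoms 𝒲 g) {u u' : G × X} (h : θ.signature S 𝒲 u = θ.signature S 𝒲 u')
    (hl : u.1 = u'.1) (hS : u.1 ∈ S) : g u.2 = g u'.2 :=
  hg _ _ fun _ hW => ⟨mem_clopen_of_signature_eq h hl hS hW,
    mem_clopen_of_signature_eq h.symm hl.symm (hl ▸ hS) hW⟩

/-- The coarser signature is the intersection of the finer one with the coarser index set. This
makes the finite-dimensional algebras increase with S and 𝒲. -/
theorem signature_eq_of_subset {S S' : Finset G} {𝒲 𝒲' : Finset (Clopens X)} (hS : S ⊆ S')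
    (hW : 𝒲 ⊆ 𝒲') {u u' : G × X} (h : θ.signature S' 𝒲' u = θ.signature S' 𝒲' u') :
    θ.signature S 𝒲 u = θ.signature S 𝒲 u' := by
  classical
  have key : ∀ w, θ.signature S 𝒲 w = θ.signature S' 𝒲' w ∩ (S ×ˢ insert ⊤ 𝒲) := by
    intro w
    ext p
    have hsub : p ∈ S ×ˢ insert ⊤ 𝒲 → p ∈ S' ×ˢ insert ⊤ 𝒲' := fun hp =>
      Finset.product_subset_product hS (Finset.insert_subset_insert _ hW) hp
    simp only [signature, Finset.mem_inter, Finset.mem_filter]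
    tauto
  rw [key, key, h]

theorem finite_range_signature (S : Finset G) (𝒲 : Finset (Clopens X)) :
    (range (θ.signature S 𝒲)).Finite := by
  classical
  refine ((S ×ˢ insert ⊤ 𝒲).powerset.finite_toSet).subset ?_
  rintro _ ⟨u, rfl⟩
  exact Finset.mem_coe.2 (Finset.mem_powerset.2 (Finset.filter_subset _ _))

end Signature

/-! ### The reduced C*-algebra -/

section Reduced

variable {G X : Type*} [AddGroup G] [TopologicalSpace G] [DiscreteTopology G]
  [TopologicalSpace X] {θ : PartialAction G X}

variable (θ) in
/-- The functions in `C_c(R)` that live on the levels in `S` and whose value at `(u, v)` depends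
only on the levels and the signature of `u` and `v`. -/
def CcFinite [T2Space X] (S : Finset G) (𝒲 : Finset (Clopens X)) :
    NonUnitalStarSubalgebra ℂ θ.Cc where
  carrier := {f | (∀ p, f.1 p ≠ 0 → p.1.1 ∈ S ∧ p.2.1 ∈ S) ∧
    ∀ p ∈ θ.rel, ∀ q ∈ θ.rel, p.1.1 = q.1.1 → p.2.1 = q.2.1 →
      θ.signature S 𝒲 p.1 = θ.signature S 𝒲 q.1 → f.1 p = f.1 q}
  add_mem' := by
    rintro f g ⟨hf, hf'⟩ ⟨hg, hg'⟩
    refine ⟨fun p hp => ?_, fun p hp q hq h1 h2 h3 => ?_⟩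
    · by_cases h : f.1 p = 0
      · refine hg p fun h' => hp ?_
        change f.1 p + g.1 p = 0
        rw [h, h', add_zero]
      · exact hf p h
    · change f.1 p + g.1 p = f.1 q + g.1 q
      rw [hf' p hp q hq h1 h2 h3, hg' p hp q hq h1 h2 h3]
  zero_mem' := ⟨fun p hp => (hp rfl).elim, fun _ _ _ _ _ _ _ => rfl⟩
  smul_mem' := by
    rintro c f ⟨hf, hf'⟩
    refine ⟨fun p hp => hf p (right_ne_zero_of_mul (a := c) hp), fun p hp q hq h1 h2 h3 => ?_⟩
    change c * f.1 p = c * f.1 q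
    rw [hf' p hp q hq h1 h2 h3]
  mul_mem' := by
    rintro f g ⟨hf, hf'⟩ ⟨hg, hg'⟩
    refine ⟨fun p hp => ?_, fun p hp q hq h1 h2 h3 => ?_⟩
    · obtain ⟨v, hv⟩ : ∃ v, f.1 (p.1, v) * g.1 (v, p.2) ≠ 0 := by
        by_contra! hall
        exact hp (finsum_eq_zero_of_forall_eq_zero hall)
      exact ⟨(hf _ (left_ne_zero_of_mul hv)).1, (hg _ (right_ne_zero_of_mul hv)).2⟩
    · change ∑ᶠ v, f.1 (p.1, v) * g.1 (v, p.2) = ∑ᶠ v, f.1 (q.1, v) * g.1 (v, q.2)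
      -- Each level contributes at most one intermediate point, so the two sums are compared term by
      -- term over `S`. Equal signatures make both intermediate points exist or both fail to exist;
      -- when they exist they inherit the common signature.
      rw [Cc.finsum_eq f hf (fun v => g.1 (v, p.2)), Cc.finsum_eq f hf (fun v => g.1 (v, q.2))]
      refine Finset.sum_congr rfl fun t ht => ?_
      by_cases hm : (p.1, θ.move p.1 t) ∈ θ.rel
      · have hm' := mem_rel_of_signature_eq h3 ht hm
        rw [hf' _ hm _ hm' h1 rfl h3, hg' (_, p.2) (θ.rel_trans (θ.rel_symm hm) hp) (_, q.2)
          (θ.rel_trans (θ.rel_symm hm') hq) rfl h2]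
        rw [← signature_eq_of_rel hm, ← signature_eq_of_rel hm', h3]
      · have hm' : (q.1, θ.move q.1 t) ∉ θ.rel := fun h =>
          hm (mem_rel_of_signature_eq h3.symm ht h)
        rw [not_not.1 (mt (Cc.mem_rel f) hm), not_not.1 (mt (Cc.mem_rel f) hm'), zero_mul,
          zero_mul]
  star_mem' := by
    rintro f ⟨hf, hf'⟩
    refine ⟨fun p hp => ?_, fun p hp q hq h1 h2 h3 => ?_⟩
    · refine (hf (p.2, p.1) fun h => hp ?_).symm
      change conj (f.1 (p.2, p.1)) = 0
      rw [h, map_zero]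
    · change conj (f.1 (p.2, p.1)) = conj (f.1 (q.2, q.1))
      rw [hf' _ (θ.rel_symm hp) _ (θ.rel_symm hq) h2 h1]
      rw [← signature_eq_of_rel hp, ← signature_eq_of_rel hq, h3]

theorem CcFinite_mono [T2Space X] {S S' : Finset G} {𝒲 𝒲' : Finset (Clopens X)} (hS : S ⊆ S')
    (hW : 𝒲 ⊆ 𝒲') : θ.CcFinite S 𝒲 ≤ θ.CcFinite S' 𝒲' := by
  rintro f ⟨hf, hf'⟩
  exact ⟨fun p hp => ⟨hS (hf p hp).1, hS (hf p hp).2⟩, fun p hp q hq h1 h2 h3 =>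
    hf' p hp q hq h1 h2 (signature_eq_of_subset hS hW h3)⟩

theorem finiteDimensional_CcFinite [T2Space X] (S : Finset G) (𝒲 : Finset (Clopens X)) :
    FiniteDimensional ℂ (θ.CcFinite S 𝒲) := by
  classical
  let E : θ.CcFinite S 𝒲 →ₗ[ℂ] ((G × X) × (G × X) → ℂ) :=
    { toFun := fun f => f.1.1
      map_add' := fun _ _ => rfl
      map_smul' := fun _ _ => rfl }
  -- The value `none` collects the pairs where every member of the algebra vanishes. One signature
  -- suffices, since both points of a pair in R have the same one.
  let q : (G × X) × (G × X) → Option (G × G × Finset (G × Clopens X)) := fun p =>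
    if p ∈ θ.rel ∧ p.1.1 ∈ S ∧ p.2.1 ∈ S then some (p.1.1, p.2.1, θ.signature S 𝒲 p.1) else none
  refine finiteDimensional_of_factors E
    (fun f g h => Subtype.ext (Subtype.ext h)) q ?_ fun f a b hab => ?_
  · have h := (S.finite_toSet.prod (S.finite_toSet.prod (finite_range_signature (θ := θ) S 𝒲)))
    refine ((h.image some).insert none).subset ?_
    rintro _ ⟨p, rfl⟩
    by_cases hp : p ∈ θ.rel ∧ p.1.1 ∈ S ∧ p.2.1 ∈ S
    · simp only [q, if_pos hp]
      exact Or.inr ⟨_, ⟨hp.2.1, hp.2.2, ⟨_, rfl⟩⟩, rfl⟩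
    · simp only [q, if_neg hp]
      exact Or.inl rfl
  · have hz : ∀ p, ¬ (p ∈ θ.rel ∧ p.1.1 ∈ S ∧ p.2.1 ∈ S) → f.1.1 p = 0 := fun p hp => by
      by_contra h
      exact hp ⟨Cc.mem_rel _ h, f.2.1 p h⟩
    change f.1.1 a = f.1.1 b
    by_cases ha : a ∈ θ.rel ∧ a.1.1 ∈ S ∧ a.2.1 ∈ S <;>
      by_cases hb : b ∈ θ.rel ∧ b.1.1 ∈ S ∧ b.2.1 ∈ S
    · simp only [q, if_pos ha, if_pos hb, Option.some.injEq, Prod.mk.injEq] at hab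
      exact f.2.2 a ha.1 b hb.1 hab.1 hab.2.1 hab.2.2
    · simp [q, if_pos ha, if_neg hb] at hab
    · simp [q, if_neg ha, if_pos hb] at hab
    · rw [hz a ha, hz b hb]

/-! ### Bounding the reduced norm by the uniform norm -/

/-- As σ is injective where the weight is nonzero, each coordinate of ξ is counted at most once in
the ℓ² sum. -/
theorem norm_le_of_weighted_comp {Y : Type*} {c : Y → ℂ} {σ : Y → Y} {C : ℝ} (hC0 : 0 ≤ C)
    (hC : ∀ v, ‖c v‖ ≤ C) (hσ : InjOn σ {v | c v ≠ 0}) (T : Ell2 Y →L[ℂ] Ell2 Y)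
    (hT : ∀ ξ v, T ξ v = c v * ξ (σ v)) : ‖T‖ ≤ C := by
  classical
  have two : (0 : ℝ) < (2 : ℝ≥0∞).toReal := by norm_num
  refine T.opNorm_le_bound hC0 fun ξ => lp.norm_le_of_forall_sum_le two (by positivity) fun s => ?_
  simp only [hT]
  have h1 : ∑ v ∈ s, ‖c v * ξ (σ v)‖ ^ (2 : ℝ≥0∞).toReal
      = ∑ v ∈ s.filter (fun v => c v ≠ 0), ‖c v * ξ (σ v)‖ ^ (2 : ℝ≥0∞).toReal := by
    rw [Finset.sum_filter_of_ne]
    intro v _ hv hcv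
    simp [hcv] at hv
  rw [h1]
  calc ∑ v ∈ s.filter (fun v => c v ≠ 0), ‖c v * ξ (σ v)‖ ^ (2 : ℝ≥0∞).toReal
      ≤ ∑ v ∈ s.filter (fun v => c v ≠ 0),
          C ^ (2 : ℝ≥0∞).toReal * ‖ξ (σ v)‖ ^ (2 : ℝ≥0∞).toReal := by
        refine Finset.sum_le_sum fun v _ => ?_
        rw [← Real.mul_rpow hC0 (norm_nonneg _), norm_mul]
        gcongr
        exact hC v
    _ = C ^ (2 : ℝ≥0∞).toReal *
          ∑ w ∈ (s.filter (fun v => c v ≠ 0)).image σ, ‖ξ w‖ ^ (2 : ℝ≥0∞).toReal := by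
        rw [← Finset.mul_sum, Finset.sum_image]
        intro a ha b hb hab
        exact hσ (Finset.mem_filter.1 ha).2 (Finset.mem_filter.1 hb).2 hab
    _ ≤ C ^ (2 : ℝ≥0∞).toReal * ‖ξ‖ ^ (2 : ℝ≥0∞).toReal := by
        gcongr
        exact lp.sum_rpow_le_norm_rpow two ξ _
    _ = _ := (Real.mul_rpow hC0 (norm_nonneg _)).symm

/-- The operator splits into |S|² blocks, one for each pair (r, t) of levels. In a block the map `u
↦ move u t` is injective on the support of the weight, since u is recovered as the point of the
class in level r; so each block has norm at most C. -/
theorem norm_regularOp_le (f : θ.Cc) {S : Finset G}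
    (hS : ∀ p, f.1 p ≠ 0 → p.1.1 ∈ S ∧ p.2.1 ∈ S) {C : ℝ} (hC0 : 0 ≤ C) (hC : ∀ p, ‖f.1 p‖ ≤ C) :
    ‖regularOp f‖ ≤ S.card * (S.card * C) := by
  classical
  have H : ∀ r t : G, ∃ T : Ell2 (G × X) →L[ℂ] Ell2 (G × X), (∀ ξ u,
      T ξ u = (if u.1 = r then f.1 (u, θ.move u t) else 0) * ξ (θ.move u t)) ∧ ‖T‖ ≤ C := by
    intro r t
    have hb : ∀ u : G × X, ‖if u.1 = r then f.1 (u, θ.move u t) else 0‖ ≤ C := by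
      intro u
      split_ifs
      · exact hC _
      · simpa using hC0
    have hi : InjOn (fun u => θ.move u t)
        {u : G × X | (if u.1 = r then f.1 (u, θ.move u t) else 0) ≠ 0} := by
      rintro u hu v hv huv
      simp only [ne_eq, mem_ofPred_eq, ite_eq_right_iff, Classical.not_imp] at hu hv
      have h1 := θ.rel_symm (Cc.mem_rel f hu.2)
      have h2 := θ.rel_symm (Cc.mem_rel f hv.2)
      simp only at huv
      rw [← huv] at h2
      rw [θ.eq_move h1, θ.eq_move h2, hu.1, hv.1]
    obtain ⟨T, hT⟩ := exists_weighted_comp _ _ C hC0 hb hi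
    exact ⟨T, hT, norm_le_of_weighted_comp hC0 hb hi T hT⟩
  choose T hT hTn using H
  have key : regularOp f = ∑ r ∈ S, ∑ t ∈ S, T r t := by
    ext ξ u
    rw [regularOp_apply, Cc.finsum_eq f hS (fun v => ξ v) u]
    simp only [sum_apply, lp.coeFn_sum, Finset.sum_apply, hT, ite_mul, zero_mul]
    rw [Finset.sum_comm]
    refine Finset.sum_congr rfl fun t _ => ?_
    rw [Finset.sum_ite_eq]
    split_ifs with h
    · rfl
    · have : f.1 (u, θ.move u t) = 0 := by
        by_contra h0
        exact h (hS _ h0).1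
      rw [this, zero_mul]
  rw [key]
  calc ‖∑ r ∈ S, ∑ t ∈ S, T r t‖ ≤ ∑ r ∈ S, ∑ t ∈ S, ‖T r t‖ :=
        (norm_sum_le _ _).trans (Finset.sum_le_sum fun r _ => norm_sum_le _ _)
    _ ≤ ∑ r ∈ S, ∑ t ∈ S, C := by gcongr; exact hTn _ _
    _ = S.card * (S.card * C) := by simp

/-! ### Density of the finite-dimensional algebras in C_c(R) -/

theorem continuousOn_move (r t : G) :
    ContinuousOn (fun x : X => θ.move (r, x) t) (θ.dom (-r + t)) := by
  refine continuousOn_const.prodMk ((θ.continuousOn_hom (-t + r)).mono ?_)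
  simp

/-- Inside the open domain this is a composition of continuous maps. At a point outside, compactness
of the support is needed: its part on levels (r, t) projects to a closed subset of the domain, so
the function is zero near that point. -/
theorem Cc.continuous_level [T2Space X] (f : θ.Cc) (r t : G) :
    Continuous fun x : X => f.1 ((r, x), θ.move (r, x) t) := by
  obtain ⟨hf, K, hK, hKc, hK0⟩ := f.2
  refine continuous_of_isOpen (θ.isOpen_dom (-r + t)) ?_ fun x hx => ?_
  · refine hf.comp ((Continuous.continuousOn (by fun_prop)).prodMk (continuousOn_move r t)) ?_
    exact fun x hx => θ.move_rel_iff.2 hx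
  · have hclosed : IsClosed {q : (G × X) × (G × X) | q.1.1 = r ∧ q.2.1 = t} :=
      (isClosed_eq (by fun_prop) continuous_const).inter
        (isClosed_eq (by fun_prop) continuous_const)
    have hP := ((hKc.inter_right hclosed).image
      (f := fun q : (G × X) × (G × X) => q.1.2) (by fun_prop)).isClosed
    have hxP : x ∉ (fun q : (G × X) × (G × X) => q.1.2) ''
        (K ∩ {q | q.1.1 = r ∧ q.2.1 = t}) := by
      rintro ⟨q, ⟨hq, h1, h2⟩, rfl⟩
      have h3 := (hK hq).1
      rw [h1, h2] at h3
      exact hx h3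
    refine (continuousAt_const (y := (0 : ℂ))).congr ?_
    filter_upwards [hP.isOpen_compl.mem_nhds hxP] with y hy
    exact (hK0 _ fun h => hy ⟨_, ⟨h, rfl, rfl⟩, rfl⟩).symm

open Classical in
/-- The function on `R` with value `g r s x` at `((r, x), (s, y))`, for `r, s ∈ S`. -/
def levelFun (θ : PartialAction G X) (S : Finset G) (g : G → G → X → ℂ)
    (p : (G × X) × (G × X)) : ℂ :=
  if p ∈ θ.rel ∧ p.1.1 ∈ S ∧ p.2.1 ∈ S then g p.1.1 p.2.1 p.1.2 else 0

/-- The set where a locally constant function is nonzero is clopen, hence compact. Here it lies in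
the domain, so `move` carries it continuously to a compact subset of R, and finitely many such sets
contain the support. -/
theorem levelFun_mem [CompactSpace X] (S : Finset G) (g : G → G → X → ℂ)
    (hg : ∀ r s, IsLocallyConstant (g r s)) (hg0 : ∀ r s, ∀ x ∉ θ.dom (-r + s), g r s x = 0) :
    θ.levelFun S g ∈ θ.Cc := by
  classical
  refine ⟨?_, ⋃ r ∈ S, ⋃ s ∈ S, (fun x : X => ((r, x), θ.move (r, x) s)) '' {x | g r s x ≠ 0},
    ?_, ?_, ?_⟩
  · have h1 : ContinuousOn (fun p : (G × X) × (G × X) =>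
        if p.1.1 ∈ S ∧ p.2.1 ∈ S then g p.1.1 p.2.1 p.1.2 else 0) θ.rel := by
      refine Continuous.continuousOn (continuous_iff_continuousAt.2 fun p => ?_)
      have o : IsOpen {q : (G × X) × (G × X) | q.1.1 = p.1.1 ∧ q.2.1 = p.2.1} :=
        ((isOpen_discrete {p.1.1}).preimage
            (f := fun q : (G × X) × (G × X) => q.1.1) (by fun_prop)).inter
          ((isOpen_discrete {p.2.1}).preimage
            (f := fun q : (G × X) × (G × X) => q.2.1) (by fun_prop))
      have hc : Continuous fun q : (G × X) × (G × X) =>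
          if p.1.1 ∈ S ∧ p.2.1 ∈ S then g p.1.1 p.2.1 q.1.2 else 0 := by
        split_ifs
        · exact (hg _ _).continuous.comp (by fun_prop)
        · exact continuous_const
      refine hc.continuousAt.congr ?_
      filter_upwards [o.mem_nhds ⟨rfl, rfl⟩] with q hq
      rw [hq.1, hq.2]
    refine h1.congr fun p hp => ?_
    simp [levelFun, hp]
  · refine iUnion₂_subset fun r _ => iUnion₂_subset fun s _ => ?_
    rintro _ ⟨x, hx, rfl⟩
    exact θ.move_rel_iff.2 (not_not.1 fun h => hx (hg0 r s x h))
  · refine S.isCompact_biUnion fun r _ => S.isCompact_biUnion fun s _ => ?_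
    have hcl : IsClosed {x | g r s x ≠ 0} := ((hg r s).isClopen_fiber 0).compl.isClosed
    refine hcl.isCompact.image_of_continuousOn
      ((Continuous.continuousOn (by fun_prop)).prodMk ((continuousOn_move r s).mono ?_))
    exact fun x hx => not_not.1 fun h => hx (hg0 r s x h)
  · intro p hp
    by_contra h
    have h1 : p ∈ θ.rel ∧ p.1.1 ∈ S ∧ p.2.1 ∈ S := by
      by_contra h2
      exact h (if_neg h2)
    have h2 : θ.levelFun S g p = g p.1.1 p.2.1 p.1.2 := if_pos h1
    refine hp (mem_iUnion₂.2 ⟨p.1.1, h1.2.1, mem_iUnion₂.2 ⟨p.2.1, h1.2.2, p.1.2, fun h0 => h (h2.trans h0), ?_⟩⟩)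
    exact Prod.ext rfl (θ.eq_move (u := p.1) (v := p.2) h1.1).symm

theorem Cc.exists_finite_approx [CompactSpace X] [T2Space X] [TotallyDisconnectedSpace X]
    (f : θ.Cc) {ε : ℝ} (hε : 0 < ε) :
    ∃ (S : Finset G) (𝒲 : Finset (Clopens X)), ∃ g ∈ θ.CcFinite S 𝒲,
      ‖regularOp f - regularOp g‖ ≤ ε := by
  classical
  obtain ⟨S, hS⟩ := Cc.exists_levels f
  obtain ⟨δ, hδ, hδε⟩ : ∃ δ > 0, S.card * (S.card * δ) ≤ ε := by
    -- The denominator absorbs the factor |S|² of `norm_regularOp_le`; adding 1 covers empty `S`.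
    refine ⟨ε / (S.card * S.card + 1), by positivity, ?_⟩
    rw [← mul_assoc, mul_div_assoc', div_le_iff₀ (by positivity)]
    nlinarith
  have H : ∀ r s : G, _ := fun r s => exists_locallyConstant_approx
    ⟨_, Cc.continuous_level f r s⟩ (U := θ.dom (-r + s)) (fun x hx =>
      not_not.1 fun h => hx (θ.move_rel_iff.1 (Cc.mem_rel f h))) hδ
  choose 𝒲 g hgl hg0 hga hgc using H
  -- One clopen family has to serve all entries at once, so those of the finitely many pairs of
  -- levels are merged.
  let 𝒱 : Finset (Clopens X) := S.biUnion fun r => S.biUnion fun s => 𝒲 r s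
  have h𝒱 : ∀ r ∈ S, ∀ s ∈ S, 𝒲 r s ⊆ 𝒱 := fun r hr s hs W hW =>
    Finset.mem_biUnion.2 ⟨r, hr, Finset.mem_biUnion.2 ⟨s, hs, hW⟩⟩
  let g' : θ.Cc := ⟨_, levelFun_mem S g hgl hg0⟩
  have hg'S : ∀ p, g'.1 p ≠ 0 → p.1.1 ∈ S ∧ p.2.1 ∈ S := by
    intro p hp
    by_contra h2
    exact hp (if_neg fun h3 => h2 h3.2)
  refine ⟨S, 𝒱, g', ⟨hg'S, fun p hp q hq h1 h2 h3 => ?_⟩, ?_⟩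
  · change θ.levelFun S g p = θ.levelFun S g q
    simp only [levelFun, hp, hq, true_and, h1, h2]
    split_ifs with h
    · exact eq_of_constantOnAtoms ((hgc _ _).mono (h𝒱 _ h.1 _ h.2)) h3 h1 (h1 ▸ h.1)
    · rfl
  · have hd : ∀ p, (f - g').1 p = f.1 p - θ.levelFun S g p := fun _ => rfl
    have hfz : ∀ p, ¬ (p ∈ θ.rel ∧ p.1.1 ∈ S ∧ p.2.1 ∈ S) → (f - g').1 p = 0 := by
      intro p hp
      have h1 : f.1 p = 0 := by
        by_contra h
        exact hp ⟨Cc.mem_rel f h, hS p h⟩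
      rw [hd, h1, levelFun, if_neg hp, sub_zero]
    have e : regularOp f - regularOp g' = regularOp (f - g') := by
      rw [sub_eq_iff_eq_add, ← regularOp_add, sub_add_cancel]
    rw [e]
    refine (norm_regularOp_le (f - g') (S := S) (fun p hp => ?_) hδ.le fun p => ?_).trans hδε
    · by_contra h
      exact hp (hfz p fun h' => h h'.2)
    · by_cases hp : p ∈ θ.rel ∧ p.1.1 ∈ S ∧ p.2.1 ∈ S
      · rw [hd, levelFun, if_pos hp]
        have h1 := hga p.1.1 p.2.1 p.1.2
        have h2 : θ.move p.1 p.2.1 = p.2 := (θ.eq_move (u := p.1) (v := p.2) hp.1).symm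
        simp only [ContinuousMap.coe_mk, Prod.mk.eta, h2] at h1
        exact h1
      · rw [hfz p hp, norm_zero]
        exact hδ.le

/-- The reduced C*-algebra of a partial action of a countable group on a compact, metrizable,
totally disconnected space is an AF-algebra. -/
theorem isAFAlgebra_reduced [Countable G] [CompactSpace X] [TopologicalSpace.MetrizableSpace X]
    [TotallyDisconnectedSpace X] (θ : PartialAction G X) : IsAFAlgebra θ.ReducedCStarAlgebra := by
  classical
  let _ := TopologicalSpace.metrizableSpaceMetric X
  -- A compact metrizable space is second countable and so has countably many clopen sets; this
  -- makes the index set of pairs (S, 𝒲) countable.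
  have : Countable (Clopens X) :=
    TopologicalSpace.Clopens.countable_iff_secondCountable.2 inferInstance
  refine isAFAlgebra_of_directed (ι := Finset G × Finset (Clopens X)) (regularRep θ)
    θ.reducedSubalgebra rfl (fun i => θ.CcFinite i.1 i.2) (fun i j h => ?_)
    (fun i => finiteDimensional_CcFinite i.1 i.2) fun f ε hε => ?_
  · exact CcFinite_mono h.1 h.2
  obtain ⟨S, 𝒲, g, hg, hfg⟩ := Cc.exists_finite_approx f hε
  exact ⟨(S, 𝒲), g, hg, hfg⟩

end Reduced

/-! ### The envelope C*-algebra -/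

section Envelope

variable {G : Type v} {X : Type u} [AddGroup G] [TopologicalSpace X] {θ : PartialAction G X}

/-- The dictionary between k_c(B) and R: the value k(r, s)(x) belongs to the pair in R that starts
at (-r, x) and ends in level -s. With this change of sign the signature of points of G × X also
serves the Fell bundle. -/
theorem move_neg_rel_iff {r s : G} {x : X} :
    ((-r, x), θ.move (-r, x) (-s)) ∈ θ.rel ↔ x ∈ θ.dom (r - s) := by
  simp [move_rel_iff, sub_eq_add_neg]

theorem move_neg (r s : G) (x : X) : θ.move (-r, x) (-s) = (-s, θ.hom (s - r) x) := by
  simp [move, sub_eq_add_neg]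

theorem rel_neg {r s : G} {x : X} (hx : x ∈ θ.dom (r - s)) :
    ((-r, x), (-s, θ.hom (s - r) x)) ∈ θ.rel := by
  rw [← move_neg]
  exact move_neg_rel_iff.2 hx

/-- By transitivity of R: the points of one class in levels -t and -s are equivalent. -/
theorem hom_mem_dom_sub {r s t : G} {x : X} (hs : x ∈ θ.dom (r - s)) (ht : x ∈ θ.dom (r - t)) :
    θ.hom (t - r) x ∈ θ.dom (t - s) := by
  have := (θ.rel_trans (θ.rel_symm (rel_neg ht)) (rel_neg hs)).1
  simpa [sub_eq_add_neg] using this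

variable [CompactSpace X] [T2Space X]

open Classical in
variable (θ) in
/-- The `k ∈ k_c(B)` that live on the levels in `S` and such that `k r s x` depends only on
`r`, `s` and the signature of the point `x` in level `-r`. -/
def KcBFinite (S : Finset G) (𝒲 : Finset (Clopens X)) : NonUnitalStarSubalgebra ℂ θ.KcB where
  carrier := {k | (∀ r s, k.1 r s ≠ 0 → r ∈ S ∧ s ∈ S) ∧
    ∀ r s, ∀ x ∈ θ.dom (r - s), ∀ y ∈ θ.dom (r - s),
      θ.signature (S.image Neg.neg) 𝒲 (-r, x) = θ.signature (S.image Neg.neg) 𝒲 (-r, y) →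
        k.1 r s x = k.1 r s y}
  add_mem' := by
    rintro k l ⟨hk, hk'⟩ ⟨hl, hl'⟩
    refine ⟨KcB.add_levels k l hk hl, fun r s x hx y hy h => ?_⟩
    rw [KcB.add_apply, KcB.add_apply, hk' r s x hx y hy h, hl' r s x hx y hy h]
  zero_mem' := ⟨fun r s h => (h rfl).elim, fun _ _ _ _ _ _ _ => rfl⟩
  smul_mem' := by
    rintro c k ⟨hk, hk'⟩
    refine ⟨fun r s h => hk r s fun h0 => h ?_, fun r s x hx y hy h => ?_⟩
    · change c • k.1 r s = 0
      rw [h0, smul_zero]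
    · change c * k.1 r s x = c * k.1 r s y
      rw [hk' r s x hx y hy h]
  mul_mem' := by
    rintro k l ⟨hk, hk'⟩ ⟨hl, hl'⟩
    refine ⟨KcB.mul_levels k l hk hl, fun r s x hx y hy h => ?_⟩
    -- The comparison is again term by term. Equal signatures put x and y both in or both out of
    -- X_{r-t}, and the factor `l` is evaluated at points of level -t in the classes of (-r, x) and
    -- (-r, y).
    rw [KcB.mul_apply k l hk, KcB.mul_apply k l hk]
    refine Finset.sum_congr rfl fun t ht => ?_
    have ht' : -t ∈ S.image Neg.neg := Finset.mem_image_of_mem _ ht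
    by_cases hxt : x ∈ θ.dom (r - t)
    · have hyt : y ∈ θ.dom (r - t) :=
        move_neg_rel_iff.1 (mem_rel_of_signature_eq h ht' (move_neg_rel_iff.2 hxt))
      rw [hk' r t x hxt y hyt h,
        hl' t s _ (hom_mem_dom_sub hx hxt) (θ.hom (t - r) y) (hom_mem_dom_sub hy hyt)]
      rw [← signature_eq_of_rel (rel_neg hxt), ← signature_eq_of_rel (rel_neg hyt), h]
    · have hyt : y ∉ θ.dom (r - t) := fun h' =>
        hxt (move_neg_rel_iff.1 (mem_rel_of_signature_eq h.symm ht' (move_neg_rel_iff.2 h')))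
      rw [KcB.eq_zero k hxt, KcB.eq_zero k hyt, zero_mul, zero_mul]
  star_mem' := by
    rintro k ⟨hk, hk'⟩
    refine ⟨KcB.star_levels k hk, fun r s x hx y hy h => ?_⟩
    rw [KcB.star_apply, KcB.star_apply, if_pos hx, if_pos hy,
      hk' s r _ (θ.hom_mem (by rwa [neg_sub])) (θ.hom (s - r) y) (θ.hom_mem (by rwa [neg_sub]))]
    rw [← signature_eq_of_rel (rel_neg hx), ← signature_eq_of_rel (rel_neg hy), h]

theorem KcBFinite_mono {S S' : Finset G} {𝒲 𝒲' : Finset (Clopens X)} (hS : S ⊆ S')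
    (hW : 𝒲 ⊆ 𝒲') : θ.KcBFinite S 𝒲 ≤ θ.KcBFinite S' 𝒲' := by
  classical
  rintro k ⟨hk, hk'⟩
  exact ⟨fun r s h => ⟨hS (hk r s h).1, hS (hk r s h).2⟩, fun r s x hx y hy h =>
    hk' r s x hx y hy (signature_eq_of_subset (Finset.image_subset_image hS) hW h)⟩

theorem finiteDimensional_KcBFinite (S : Finset G) (𝒲 : Finset (Clopens X)) :
    FiniteDimensional ℂ (θ.KcBFinite S 𝒲) := by
  classical
  let E : θ.KcBFinite S 𝒲 →ₗ[ℂ] (G × G × X → ℂ) :=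
    { toFun := fun k p => k.1.1 p.1 p.2.1 p.2.2
      map_add' := fun _ _ => rfl
      map_smul' := fun _ _ => rfl }
  let q : G × G × X → Option (G × G × Finset (G × Clopens X)) := fun p =>
    if p.2.2 ∈ θ.dom (p.1 - p.2.1) ∧ p.1 ∈ S ∧ p.2.1 ∈ S then
      some (p.1, p.2.1, θ.signature (S.image Neg.neg) 𝒲 (-p.1, p.2.2)) else none
  refine finiteDimensional_of_factors E (fun k l h => Subtype.ext (KcB.ext_apply fun r s x =>
    congrFun h (r, s, x))) q ?_ fun k a b hab => ?_
  · have h := S.finite_toSet.prod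
      (S.finite_toSet.prod (finite_range_signature (θ := θ) (S.image Neg.neg) 𝒲))
    refine ((h.image some).insert none).subset ?_
    rintro _ ⟨p, rfl⟩
    by_cases hp : p.2.2 ∈ θ.dom (p.1 - p.2.1) ∧ p.1 ∈ S ∧ p.2.1 ∈ S
    · simp only [q, if_pos hp]
      exact Or.inr ⟨_, ⟨hp.2.1, hp.2.2, ⟨_, rfl⟩⟩, rfl⟩
    · simp only [q, if_neg hp]
      exact Or.inl rfl
  · have hz : ∀ p : G × G × X, ¬ (p.2.2 ∈ θ.dom (p.1 - p.2.1) ∧ p.1 ∈ S ∧ p.2.1 ∈ S) →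
        k.1.1 p.1 p.2.1 p.2.2 = 0 := fun p hp => by
      by_contra h
      refine hp ⟨not_not.1 fun h' => h (KcB.eq_zero _ h'), k.2.1 _ _ fun h' => h ?_⟩
      rw [h']
      rfl
    change k.1.1 a.1 a.2.1 a.2.2 = k.1.1 b.1 b.2.1 b.2.2
    obtain ⟨r, s, x⟩ := a
    obtain ⟨r', s', y⟩ := b
    by_cases ha : x ∈ θ.dom (r - s) ∧ r ∈ S ∧ s ∈ S <;>
      by_cases hb : y ∈ θ.dom (r' - s') ∧ r' ∈ S ∧ s' ∈ S
    · simp only [q, if_pos ha, if_pos hb, Option.some.injEq, Prod.mk.injEq] at hab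
      obtain ⟨rfl, rfl, hab⟩ := hab
      exact k.2.2 r s x ha.1 y hb.1 hab
    · simp [q, if_pos ha, if_neg hb] at hab
    · simp [q, if_neg ha, if_pos hb] at hab
    · exact (hz (r, s, x) ha).trans (hz (r', s', y) hb).symm

/-! ### Norm estimates and density in k_c(B) -/

theorem hsNorm_le (k : θ.KcB) {S : Finset G} (hS : ∀ r s, k.1 r s ≠ 0 → r ∈ S ∧ s ∈ S) {C : ℝ}
    (hC0 : 0 ≤ C) (hC : ∀ r s, ‖k.1 r s‖ ≤ C) : KcB.hsNorm k ≤ S.card * C := by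
  refine Real.sqrt_le_iff.2 ⟨by positivity, ?_⟩
  rw [finsum_eq_sum_of_support_subset (s := S ×ˢ S)]
  · calc ∑ p ∈ S ×ˢ S, ‖k.1 p.1 p.2‖ ^ 2 ≤ ∑ p ∈ S ×ˢ S, C ^ 2 := by gcongr; exact hC _ _
      _ = (S.card * C) ^ 2 := by
        rw [Finset.sum_const, Finset.card_product, nsmul_eq_mul]
        push_cast
        ring
  · intro p hp
    refine Finset.mem_coe.2 (Finset.mem_product.2 (hS _ _ fun h => hp ?_))
    simp [h]

/-- Contractivity of every representation passes to the supremum. Approximation in the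
Hilbert–Schmidt norm is therefore enough, and no particular representation of k(B) has to be
understood. -/
theorem norm_universalRep_le (k : θ.KcB) : ‖universalRep θ k‖ ≤ KcB.hsNorm k :=
  lp.norm_le_of_forall_le (Real.sqrt_nonneg _) fun π => π.norm_le k

theorem KcB.exists_finite_approx [TotallyDisconnectedSpace X] (k : θ.KcB) {ε : ℝ} (hε : 0 < ε) :
    ∃ (S : Finset G) (𝒲 : Finset (Clopens X)), ∃ l ∈ θ.KcBFinite S 𝒲,
      KcB.hsNorm (k - l) ≤ ε := by
  classical
  obtain ⟨S, hS⟩ := KcB.exists_levels k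
  obtain ⟨δ, hδ, hδε⟩ : ∃ δ > 0, S.card * δ ≤ ε := by
    refine ⟨ε / (S.card + 1), by positivity, ?_⟩
    rw [mul_div_assoc', div_le_iff₀ (by positivity)]
    nlinarith
  have H : ∀ r s : G, _ := fun r s => exists_locallyConstant_approx (k.1 r s)
    (U := θ.dom (r - s)) (fun x hx => KcB.eq_zero k hx) hδ
  choose 𝒲 g hgl hg0 hga hgc using H
  let 𝒱 : Finset (Clopens X) := S.biUnion fun r => S.biUnion fun s => 𝒲 r s
  have h𝒱 : ∀ r ∈ S, ∀ s ∈ S, 𝒲 r s ⊆ 𝒱 := fun r hr s hs W hW =>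
    Finset.mem_biUnion.2 ⟨r, hr, Finset.mem_biUnion.2 ⟨s, hs, hW⟩⟩
  -- Entries off `S × S` are set to 0 for finite support; there `k` vanishes too, so the cut adds no
  -- error.
  let c : G → G → C(X, ℂ) := fun r s =>
    if r ∈ S ∧ s ∈ S then ⟨g r s, (hgl r s).continuous⟩ else 0
  have hcS : ∀ r s, c r s ≠ 0 → r ∈ S ∧ s ∈ S := fun r s h => by
    by_contra h'
    exact h (if_neg h')
  have hc : c ∈ θ.KcB := by
    refine ⟨fun r s x hx => ?_, (S.finite_toSet.prod S.finite_toSet).subset fun p hp => hcS _ _ hp⟩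
    simp only [c]
    split_ifs
    · exact hg0 r s x hx
    · rfl
  refine ⟨S, 𝒱, ⟨c, hc⟩, ⟨hcS, fun r s x hx y hy h => ?_⟩, ?_⟩
  · simp only [c]
    split_ifs with h'
    · exact eq_of_constantOnAtoms ((hgc r s).mono (h𝒱 r h'.1 s h'.2)) h rfl
        (Finset.mem_image_of_mem _ h'.1)
    · rfl
  · have hd : ∀ r s, (k - ⟨c, hc⟩ : θ.KcB).1 r s = k.1 r s - c r s := fun _ _ => rfl
    have hz : ∀ r s, ¬ (r ∈ S ∧ s ∈ S) → (k - ⟨c, hc⟩ : θ.KcB).1 r s = 0 := fun r s h => by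
      rw [hd, not_not.1 (mt (hS r s) h), not_not.1 (mt (hcS r s) h), sub_zero]
    refine (hsNorm_le _ (S := S) (fun r s h => not_not.1 (mt (hz r s) h)) hδ.le
      fun r s => ?_).trans hδε
    by_cases h : r ∈ S ∧ s ∈ S
    · rw [hd, ContinuousMap.norm_le _ hδ.le]
      intro x
      simp only [c, if_pos h]
      exact hga r s x
    · rw [hz r s h, norm_zero]
      exact hδ.le

end Envelope

/-- The envelope C*-algebra of a partial action of a countable group on a compact, metrizable,
totally disconnected space is an AF-algebra. -/
theorem isAFAlgebra_envelope {G : Type v} {X : Type u} [AddGroup G] [TopologicalSpace X]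
    [Countable G] [CompactSpace X] [TopologicalSpace.MetrizableSpace X]
    [TotallyDisconnectedSpace X] (θ : PartialAction G X) : IsAFAlgebra θ.EnvelopeCStarAlgebra := by
  classical
  let _ := TopologicalSpace.metrizableSpaceMetric X
  have : Countable (Clopens X) :=
    TopologicalSpace.Clopens.countable_iff_secondCountable.2 inferInstance
  refine isAFAlgebra_of_directed (ι := Finset G × Finset (Clopens X)) (universalRep θ)
    θ.envelopeSubalgebra rfl (fun i => θ.KcBFinite i.1 i.2) (fun i j h => ?_)
    (fun i => finiteDimensional_KcBFinite i.1 i.2) fun k ε hε => ?_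
  · exact KcBFinite_mono h.1 h.2
  · obtain ⟨S, 𝒲, l, hl, hkl⟩ := KcB.exists_finite_approx k hε
    refine ⟨(S, 𝒲), l, hl, ?_⟩
    rw [← map_sub]
    exact (norm_universalRep_le _).trans hkl

end PartialAction

end

/-! ### The case of ℤ acting by the powers of h -/

theorem mainTheorem2 {X : Type*} [TopologicalSpace X] [CompactSpace X]
    [TopologicalSpace.MetrizableSpace X] [TotallyDisconnectedSpace X] [PerfectSpace X]
    (h : OpenPartialHomeomorph X X) (hU : h.source ≠ Set.univ) :
    IsAFAlgebra (PartialAction.ofHomeo h).ReducedCStarAlgebra ∧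
      IsAFAlgebra (PartialAction.ofHomeo h).EnvelopeCStarAlgebra :=
  ⟨PartialAction.isAFAlgebra_reduced _, PartialAction.isAFAlgebra_envelope _⟩
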